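/- Let $R$ be a left coherent ring (every finitely generated left ideal is finitely presented), so that the category $R\text{-mod}$ of finitely presented left $R$-modules is abelian. Let $\mathbf{D}_{\rm sg}(R)=\mathbf{D}^b(R\text{-mod})/\mathbf{K}^b(R\text{-proj})$ be its singularity category, that is, the Verdier quotient of the bounded derived category of $R\text{-mod}$ by the perfect complexes (those isomorphic to bounded complexes of finitely generated projective modules). A complex $P$ of finitely generated projective left $R$-modules is totally acyclic if $P$ and $\mathrm{Hom}_R(P,R)$ are acyclic; a finitely presented module $G$ is Gorenstein projective if $G\cong Z^1(P)=\mathrm{Ker}(P^1\to P^2)$ for some totally acyclic $P$. Let $R\text{-}\underline{\mathrm{Gproj}}$ be the stable category of finitely presented Gorenstein projective modules: morphisms are module homomorphisms modulo those that factor through a projective module. It carries the triangulated structure of the stable category of a Frobenius exact category: choosing for each $X$ an exact sequence $0\to X\to I(X)\to \Sigma X\to 0$ with $I(X)$ finitely generated projective and $\Sigma X$ Gorenstein projective, the suspension is $\Sigma$, and the exact triangles are those isomorphic to $X\xrightarrow{u} Y\to C_u\to\Sigma X$, where $C_u$ is the pushout of a homomorphism $u\colon X\to Y$ along $X\to I(X)$.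 Let $$\Phi_R\colon R\text{-}\underline{\mathrm{Gproj}}\longrightarrow \mathbf{D}_{\rm sg}(R)$$ be the functor induced by sending a module to the corresponding stalk complex concentrated in degree zero. Then $\Phi_R$ is a fully faithful triangle functor. Moreover, the following three conditions are equivalent: 1. $\Phi_R$ is dense; 2. $\Phi_R$ is dense up to direct summands, that is, every object of $\mathbf{D}_{\rm sg}(R)$ is a direct summand of $\Phi_R(G)$ for some Gorenstein projective $G$; 3. $R$ is left G-regular, that is, every finitely presented left $R$-module $M$ has finite Gorenstein projective dimension: for some $n\ge 0$ there is an exact sequence $0\to G_n\to\cdots\to G_1\to G_0\to M\to 0$ with each $G_i$ finitely presented Gorenstein projective. -/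

import Mathlib

open CategoryTheory Limits

universe u

namespace SingCat

/-- A ring is left coherent if every finitely generated left ideal is finitely presented
(`Ideal R` consists of the left ideals and `Module R` of the left modules). -/
class IsLeftCoherentRing (R : Type u) [Ring R] : Prop where
  finitePresentation_of_fg : ∀ I : Ideal R, I.FG → Module.FinitePresentation R I

/-- The property of being a finitely presented left `R`-module. -/
def isFinitelyPresented (R : Type u) [Ring R] : ObjectProperty (ModuleCat.{u} R) :=
  fun M => Module.FinitePresentation R M

/-- The category `R-mod` of finitely presented left `R`-modules. It is abelian when `R` is left
coherent, as follows from the closure properties proved below. -/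
abbrev FPMod (R : Type u) [Ring R] := (isFinitelyPresented R).FullSubcategory

section
variable (R : Type u) [Ring R]

lemma finitePresentation_submodule_pi [IsLeftCoherentRing R] (n : ℕ) :
    ∀ N : Submodule R (Fin n → R), N.FG → Module.FinitePresentation R N := by
  induction n with
  | zero => intro N _; infer_instance
  | succ n ih =>
    intro N hN
    -- projection to the first coordinate
    let p : N →ₗ[R] R := (LinearMap.proj (0 : Fin (n+1))) ∘ₗ N.subtype
    have : Module.Finite R N := Module.Finite.iff_fg.2 hN
    have hI : (LinearMap.range p).FG := by
      exact Module.Finite.iff_fg.1 inferInstance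
    have hfp : Module.FinitePresentation R (LinearMap.range p) :=
      IsLeftCoherentRing.finitePresentation_of_fg _ hI
    have hker : (LinearMap.ker p.rangeRestrict).FG :=
      Module.FinitePresentation.fg_ker _ p.surjective_rangeRestrict
    -- the kernel embeds in the remaining coordinates
    let q : LinearMap.ker p.rangeRestrict →ₗ[R] (Fin n → R) :=
      (LinearMap.funLeft R R Fin.succ) ∘ₗ N.subtype ∘ₗ (LinearMap.ker p.rangeRestrict).subtype
    have hq : Function.Injective q := by
      rw [injective_iff_map_eq_zero]
      rintro ⟨⟨x, hx⟩, hx'⟩ h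
      have h0 : x 0 = 0 := by
        have := congrArg Subtype.val (LinearMap.mem_ker.1 hx')
        exact this
      have hs : ∀ i : Fin n, x i.succ = 0 := fun i => congrFun h i
      apply Subtype.ext; apply Subtype.ext; funext i
      refine Fin.cases h0 hs i
    have hfk : Module.Finite R (LinearMap.ker p.rangeRestrict) := Module.Finite.iff_fg.2 hker
    have : Module.FinitePresentation R (LinearMap.range q) :=
      ih _ (Module.Finite.iff_fg.1 inferInstance)
    have : Module.FinitePresentation R (LinearMap.ker p.rangeRestrict) :=
      Module.FinitePresentation.of_equiv (M := LinearMap.range q)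
        (N := LinearMap.ker p.rangeRestrict) (LinearEquiv.ofInjective q hq).symm
    exact Module.finitePresentation_of_ker _ p.surjective_rangeRestrict

lemma finitePresentation_submodule [IsLeftCoherentRing R] {M : Type u} [AddCommGroup M] [Module R M]
    [Module.FinitePresentation R M] (N : Submodule R M) (hN : N.FG) :
    Module.FinitePresentation R N := by
  obtain ⟨n, K, e, hK⟩ := Module.FinitePresentation.exists_fin R M
  let f : (Fin n → R) →ₗ[R] M := e.symm.toLinearMap ∘ₗ K.mkQ
  have hf : Function.Surjective f := e.symm.surjective.comp K.mkQ_surjective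
  have hkf : LinearMap.ker f = K := by
    simp [f, LinearMap.ker_comp]
  let N' : Submodule R (Fin n → R) := N.comap f
  have hN' : N'.FG := by
    apply Submodule.fg_of_fg_map_of_fg_inf_ker f
    · rw [Submodule.map_comap_eq_of_surjective hf]; exact hN
    · rw [inf_eq_right.2 (by rw [← Submodule.comap_bot]; exact Submodule.comap_mono bot_le), hkf]
      exact hK
  have h1 := finitePresentation_submodule_pi R n N' hN'
  let g : N' →ₗ[R] N := f.restrict (fun x hx => hx)
  have hg : Function.Surjective g := by
    rintro ⟨y, hy⟩
    obtain ⟨x, rfl⟩ := hf y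
    exact ⟨⟨x, hy⟩, rfl⟩
  refine Module.finitePresentation_of_surjective g hg ?_
  have hle : K ≤ N' := by rw [← hkf, ← Submodule.comap_bot]; exact Submodule.comap_mono bot_le
  have hkg : LinearMap.ker g = K.comap N'.subtype := by
    rw [← hkf]; ext x
    simp [g, Subtype.ext_iff]
  rw [hkg]
  have : Module.Finite R K := Module.Finite.iff_fg.2 hK
  exact Module.Finite.iff_fg.1 (Module.Finite.equiv (Submodule.comapSubtypeEquivOfLe hle).symm)

instance : (isFinitelyPresented R).IsClosedUnderIsomorphisms where
  of_iso e h := by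
    have : Module.FinitePresentation R _ := h
    exact Module.FinitePresentation.of_equiv e.toLinearEquiv

instance : (isFinitelyPresented R).ContainsZero where
  exists_zero := ⟨ModuleCat.of R PUnit, ModuleCat.isZero_of_subsingleton _,
    (inferInstance : Module.FinitePresentation R PUnit.{u+1})⟩

instance : (isFinitelyPresented R).IsClosedUnderCokernels where
  cokernels_le := by
    rintro C ⟨f, k, hk, hX, hY⟩
    rename_i X Y
    have : Module.FinitePresentation R X := hX
    have : Module.FinitePresentation R Y := hY
    have h := IsColimit.coconePointUniqueUpToIso hk (ModuleCat.cokernelIsColimit f)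
    refine (isFinitelyPresented R).prop_of_iso h.symm ?_
    have hfg : (LinearMap.range f.hom).FG := Module.Finite.iff_fg.1 inferInstance
    exact Module.finitePresentation_of_surjective (LinearMap.range f.hom).mkQ
      (Submodule.mkQ_surjective _) ((Submodule.ker_mkQ (LinearMap.range f.hom)).symm ▸ hfg)

instance [IsLeftCoherentRing R] : (isFinitelyPresented R).IsClosedUnderKernels where
  kernels_le := by
    rintro C ⟨f, k, hk, hX, hY⟩
    rename_i X Y
    have : Module.FinitePresentation R X := hX
    have : Module.FinitePresentation R Y := hY
    have h := IsLimit.conePointUniqueUpToIso hk (ModuleCat.kernelIsLimit f)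
    refine (isFinitelyPresented R).prop_of_iso h.symm ?_
    have : Module.FinitePresentation R (LinearMap.range f.hom) :=
      finitePresentation_submodule R _ (Module.Finite.iff_fg.1 inferInstance)
    have hk : (LinearMap.ker f.hom).FG := by
      have := Module.FinitePresentation.fg_ker f.hom.rangeRestrict f.hom.surjective_rangeRestrict
      rwa [LinearMap.ker_rangeRestrict] at this
    exact finitePresentation_submodule R _ hk

instance : (isFinitelyPresented R).IsClosedUnderFiniteProducts :=
  have : (isFinitelyPresented R).IsClosedUnderBinaryProducts := by
    constructor
    rintro C ⟨p⟩
    have h1 : Module.FinitePresentation R (p.diag.obj ⟨.left⟩) := p.prop_diag_obj _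
    have h2 : Module.FinitePresentation R (p.diag.obj ⟨.right⟩) := p.prop_diag_obj _
    have h := (IsLimit.postcomposeHomEquiv (diagramIsoPair p.diag) _).2 p.isLimit
    refine (isFinitelyPresented R).prop_of_iso (h.conePointUniqueUpToIso (ModuleCat.binaryProductLimitCone _ _).isLimit).symm ?_
    exact Module.FinitePresentation.prod (R := R) (p.diag.obj ⟨.left⟩) (p.diag.obj ⟨.right⟩)
  .mk'

end

section
variable (R : Type u) [Ring R]

/-- A complex `P` of left `R`-modules (cohomological indexing) is a totally acyclic complex of
finitely generated projective modules: each `P.X i` is finitely generated projective, `P` is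
acyclic, and the dual complex `Hom_R(P, R)` is acyclic. -/
structure IsTotallyAcyclic {R : Type u} [Ring R] (P : CochainComplex (ModuleCat.{u} R) ℤ) : Prop where
  finite : ∀ i, Module.Finite R (P.X i)
  projective : ∀ i, Module.Projective R (P.X i)
  exact : ∀ i j k, i + 1 = j → j + 1 = k → Function.Exact (P.d i j).hom (P.d j k).hom
  dual_exact : ∀ i j k, i + 1 = j → j + 1 = k →
    Function.Exact (fun φ : P.X k →ₗ[R] R => φ ∘ₗ (P.d j k).hom)
      (fun φ : P.X j →ₗ[R] R => φ ∘ₗ (P.d i j).hom)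

/-- A finitely presented module `G` is Gorenstein projective if it is isomorphic to the cocycles
`Z¹(P) = Ker (P¹ ⟶ P²)` of a totally acyclic complex `P` of finitely generated projectives. -/
def isGorensteinProjective : ObjectProperty (FPMod R) := fun G =>
  ∃ P : CochainComplex (ModuleCat.{u} R) ℤ, IsTotallyAcyclic P ∧
    Nonempty (G.obj ≃ₗ[R] LinearMap.ker (P.d 1 2).hom)

/-- The category `R-Gproj` of finitely presented Gorenstein projective modules. -/
abbrev Gproj := (isGorensteinProjective R).FullSubcategory

/-- The property that a finitely presented module is projective. -/
def isProj : ObjectProperty (FPMod R) := fun P => Module.Projective R P.obj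

variable {R}

lemma FPMod.surjective_of_epi {X Y : FPMod R} (f : X ⟶ Y) [Epi f] :
    Function.Surjective f.hom.hom := by
  have := (isFinitelyPresented R).preservesEpimorphisms_ι_of_isNormalMonoCategory
  have : Epi f.hom := inferInstanceAs (Epi ((isFinitelyPresented R).ι.map f))
  exact (ModuleCat.epi_iff_surjective f.hom).1 this

lemma isProj_iff (P : FPMod R) : isProj R P ↔ Projective P := by
  constructor
  · intro h
    have : Module.Projective R P.obj := h
    refine ⟨fun {E X} f e _ => ?_⟩
    obtain ⟨g, hg⟩ := Module.projective_lifting_property e.hom.hom f.hom.hom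
      (FPMod.surjective_of_epi e)
    exact ⟨ObjectProperty.homMk (ModuleCat.ofHom g), by ext x; exact LinearMap.congr_fun hg x⟩
  · intro h
    have : Module.FinitePresentation R P.obj := P.property
    obtain ⟨n, m, f, -, hf, -⟩ := Module.FinitePresentation.exists_fin' R P.obj
    let F : FPMod R := ⟨ModuleCat.of R (Fin n → R),
      (inferInstance : Module.FinitePresentation R (Fin n → R))⟩
    let f' : F ⟶ P := ObjectProperty.homMk (ModuleCat.ofHom f)
    have : Epi f' := by
      have : Epi ((isFinitelyPresented R).ι.map f') := (ModuleCat.epi_iff_surjective _).2 hf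
      exact (isFinitelyPresented R).ι.epi_of_epi_map this
    obtain ⟨s, hs⟩ := Projective.factors (𝟙 P) f'
    exact Module.Projective.of_split (M := Fin n → R) s.hom.hom f
      (congrArg (fun g => g.hom.hom) hs)

lemma IsTotallyAcyclic.dual_exact_proj {P : CochainComplex (ModuleCat.{u} R) ℤ}
    (hP : IsTotallyAcyclic P) {Q : Type u} [AddCommGroup Q] [Module R Q] [Module.Finite R Q]
    [Module.Projective R Q] {i j k : ℤ} (hij : i + 1 = j) (hjk : j + 1 = k)
    (f : P.X j →ₗ[R] Q) (hf : f ∘ₗ (P.d i j).hom = 0) :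
    ∃ g : P.X k →ₗ[R] Q, g ∘ₗ (P.d j k).hom = f := by
  obtain ⟨n, r, s, _, _, hrs⟩ := Module.Finite.exists_comp_eq_id_of_projective R Q
  have h (m : Fin n) : ∃ g : P.X k →ₗ[R] R, g ∘ₗ (P.d j k).hom = LinearMap.proj m ∘ₗ s ∘ₗ f :=
    (hP.dual_exact i j k hij hjk _).1 (by
      change LinearMap.proj m ∘ₗ s ∘ₗ f ∘ₗ (P.d i j).hom = 0
      rw [hf]; simp)
  choose g hg using h
  refine ⟨r ∘ₗ LinearMap.pi g, ?_⟩
  have : LinearMap.pi g ∘ₗ (P.d j k).hom = s ∘ₗ f := by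
    ext x m
    exact LinearMap.congr_fun (hg m) x
  rw [LinearMap.comp_assoc, this, ← LinearMap.comp_assoc, hrs, LinearMap.id_comp]

lemma isGorensteinProjective.exists_extension {C : FPMod R} (hC : isGorensteinProjective R C)
    {A B Q : Type u} [AddCommGroup A] [Module R A] [AddCommGroup B] [Module R B]
    [AddCommGroup Q] [Module R Q] [Module.Finite R Q] [Module.Projective R Q]
    (i : A →ₗ[R] B) (p : B →ₗ[R] C.obj) (hi : Function.Injective i) (hp : Function.Surjective p)
    (hip : Function.Exact i p) (a : A →ₗ[R] Q) : ∃ b : B →ₗ[R] Q, b ∘ₗ i = a := by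
  obtain ⟨P, hP, ⟨e⟩⟩ := hC
  have dd (i j k : ℤ) (x : P.X i) : (P.d j k).hom ((P.d i j).hom x) = 0 := by
    have := P.d_comp_d i j k
    exact LinearMap.congr_fun (congrArg ModuleCat.Hom.hom this) x
  let d0 : P.X 0 →ₗ[R] LinearMap.ker (P.d 1 2).hom :=
    (P.d 0 1).hom.codRestrict _ (fun x => dd 0 1 2 x)
  let ε : P.X 0 →ₗ[R] C.obj := e.symm.toLinearMap ∘ₗ d0
  have hε (x : P.X 0) : ε x = 0 ↔ (P.d 0 1).hom x = 0 := by
    rw [LinearMap.comp_apply, LinearEquiv.coe_coe, LinearEquiv.map_eq_zero_iff, Subtype.ext_iff]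
    rfl
  have hεs : Function.Surjective ε := by
    refine e.symm.surjective.comp ?_
    rintro ⟨y, hy⟩
    obtain ⟨x, rfl⟩ := (hP.exact 0 1 2 rfl rfl y).1 hy
    exact ⟨x, rfl⟩
  have := hP.projective 0
  obtain ⟨l, hl⟩ := Module.projective_lifting_property p ε hp
  have hl' (x) : p (l x) = ε x := LinearMap.congr_fun hl x
  let b' : P.X (-1) →ₗ[R] A := (LinearEquiv.ofInjective i hi).symm.toLinearMap ∘ₗ
    (l ∘ₗ (P.d (-1) 0).hom).codRestrict (LinearMap.range i) (fun x => by
      refine (hip _).1 ?_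
      rw [LinearMap.comp_apply, hl', hε]
      exact dd _ _ _ x)
  have hb' (x) : i (b' x) = l ((P.d (-1) 0).hom x) :=
    congrArg Subtype.val ((LinearEquiv.ofInjective i hi).apply_symm_apply
      ((l ∘ₗ (P.d (-1) 0).hom).codRestrict (LinearMap.range i) _ x))
  obtain ⟨c, hc⟩ := hP.dual_exact_proj (i := -2) (j := -1) (k := 0) rfl rfl (a ∘ₗ b') (by
    ext x
    have : b' ((P.d (-2) (-1)).hom x) = 0 := hi (by
      rw [hb', dd, map_zero, map_zero])
    simp [this])
  have hc' (x) : c ((P.d (-1) 0).hom x) = a (b' x) := LinearMap.congr_fun hc x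
  let ψ : (A × P.X 0) →ₗ[R] B := i.coprod l
  let φ : (A × P.X 0) →ₗ[R] Q := a.coprod c
  have hψ : Function.Surjective ψ := by
    intro y
    obtain ⟨x, hx⟩ := hεs (p y)
    obtain ⟨z, hz⟩ := (hip (y - l x)).1 (by rw [map_sub, hl', hx, sub_self])
    exact ⟨(z, x), by simp [ψ, hz]⟩
  have hker : LinearMap.ker ψ ≤ LinearMap.ker φ := by
    rintro ⟨x, y⟩ h
    have h : i x + l y = 0 := h
    have hy : (P.d 0 1).hom y = 0 := by
      rw [← hε, ← hl', eq_neg_of_add_eq_zero_right h, map_neg, hip.apply_apply_eq_zero, neg_zero]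
    obtain ⟨z, rfl⟩ := (hP.exact (-1) 0 1 rfl rfl y).1 hy
    have hx : x = - b' z := hi (by rw [map_neg, hb']; exact eq_neg_of_add_eq_zero_left h)
    change a x + c ((P.d (-1) 0).hom z) = 0
    rw [hc', hx, map_neg, neg_add_cancel]
  refine ⟨(LinearMap.ker ψ).liftQ φ hker ∘ₗ (ψ.quotKerEquivOfSurjective hψ).symm.toLinearMap, ?_⟩
  ext x
  have : (ψ.quotKerEquivOfSurjective hψ).symm (i x) = Submodule.Quotient.mk (x, 0) := by
    rw [LinearEquiv.symm_apply_eq]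
    simp [ψ]
  rw [LinearMap.comp_apply, LinearMap.comp_apply, LinearEquiv.coe_coe, this]
  simp [φ]

/-- A short exact sequence `0 ⟶ X ⟶ I ⟶ S ⟶ 0` of finitely presented modules with `I` projective
and `S` Gorenstein projective, that is, a conflation of the Frobenius exact category `R-Gproj`
starting at `X` whose middle term is projective-injective. -/
structure Cosyzygy (X : Gproj R) where
  I : FPMod R
  S : Gproj R
  ι : X.obj ⟶ I
  π : I ⟶ S.obj
  projective : isProj R I
  injective : Function.Injective ι.hom.hom
  surjective : Function.Surjective π.hom.hom
  exact : Function.Exact ι.hom.hom π.hom.hom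

lemma nonempty_cosyzygy (X : Gproj R) : Nonempty (Cosyzygy X) := by
  obtain ⟨G, P, hP, ⟨e⟩⟩ := X
  have dd (i j k : ℤ) (x : P.X i) : (P.d j k).hom ((P.d i j).hom x) = 0 := by
    have := P.d_comp_d i j k
    exact LinearMap.congr_fun (congrArg ModuleCat.Hom.hom this) x
  have := hP.projective
  have := hP.finite
  have : Module.FinitePresentation R G.obj := G.property
  have hI : Module.FinitePresentation R (P.X 1) := Module.finitePresentation_of_projective _ _
  let π : P.X 1 →ₗ[R] LinearMap.ker (P.d 2 3).hom :=
    (P.d 1 2).hom.codRestrict _ (fun x => dd 1 2 3 x)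
  have hπ : Function.Surjective π := by
    rintro ⟨y, hy⟩
    obtain ⟨x, rfl⟩ := (hP.exact 1 2 3 rfl rfl y).1 hy
    exact ⟨x, rfl⟩
  have hkπ : LinearMap.ker π = LinearMap.ker (P.d 1 2).hom := LinearMap.ker_codRestrict _ _ _
  have hS : Module.FinitePresentation R (LinearMap.ker (P.d 2 3).hom) := by
    refine Module.finitePresentation_of_surjective π hπ ?_
    rw [hkπ]
    exact Module.Finite.iff_fg.1 (Module.Finite.equiv e)
  let P' : CochainComplex (ModuleCat.{u} R) ℤ :=
    { X := fun i => P.X (i + 1)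
      d := fun i j => P.d (i + 1) (j + 1)
      shape := fun i j h => P.shape _ _ (fun h' => h (by
        simp only [ComplexShape.up_Rel] at h' ⊢; lia))
      d_comp_d' := fun _ _ _ _ _ => P.d_comp_d _ _ _ }
  have hP' : IsTotallyAcyclic P' :=
    { finite := fun _ => hP.finite _
      projective := fun _ => hP.projective _
      exact := fun i j k h h' => hP.exact _ _ _ (by lia) (by lia)
      dual_exact := fun i j k h h' => hP.dual_exact _ _ _ (by lia) (by lia) }
  exact ⟨{
    I := ⟨P.X 1, hI⟩
    S := ⟨⟨ModuleCat.of R (LinearMap.ker (P.d 2 3).hom), hS⟩,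
      P', hP', ⟨LinearEquiv.refl R (LinearMap.ker (P.d 2 3).hom)⟩⟩
    ι := ObjectProperty.homMk (ModuleCat.ofHom ((LinearMap.ker (P.d 1 2).hom).subtype ∘ₗ e.toLinearMap))
    π := ObjectProperty.homMk (ModuleCat.ofHom π)
    projective := hP.projective 1
    injective := Subtype.val_injective.comp e.injective
    surjective := hπ
    exact := fun y => by
      constructor
      · intro h
        exact ⟨e.symm ⟨y, by rw [← hkπ]; exact h⟩,
          congrArg Subtype.val (e.apply_symm_apply _)⟩
      · rintro ⟨x, rfl⟩
        have : (e x).1 ∈ LinearMap.ker π := by rw [hkπ]; exact (e x).2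
        exact this }⟩

/-- A choice, for each Gorenstein projective `X`, of a conflation `0 ⟶ X ⟶ I(X) ⟶ S(X) ⟶ 0`. -/
noncomputable def cosyzygy (X : Gproj R) : Cosyzygy X := (nonempty_cosyzygy X).some

namespace Cosyzygy
variable {X : Gproj R} (c : Cosyzygy X)

lemma ι_π : c.ι ≫ c.π = 0 := by
  ext x
  exact c.exact.apply_apply_eq_zero x

lemma exists_ext {J : FPMod R} (hJ : isProj R J) (f : X.obj ⟶ J) :
    ∃ g : c.I ⟶ J, c.ι ≫ g = f := by
  have : Module.Projective R J.obj := hJ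
  have : Module.FinitePresentation R J.obj := J.property
  obtain ⟨b, hb⟩ := c.S.property.exists_extension c.ι.hom.hom c.π.hom.hom c.injective c.surjective
    c.exact f.hom.hom
  exact ⟨ObjectProperty.homMk (ModuleCat.ofHom b), by
    ext x; exact LinearMap.congr_fun hb x⟩

lemma exists_desc {Z : FPMod R} (g : c.I ⟶ Z) (hg : c.ι ≫ g = 0) :
    ∃ h : c.S.obj ⟶ Z, c.π ≫ h = g := by
  have hg' (x) : g.hom.hom (c.ι.hom.hom x) = 0 :=
    LinearMap.congr_fun (congrArg (fun f => f.hom.hom) hg) x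
  have hker : LinearMap.ker c.π.hom.hom ≤ LinearMap.ker g.hom.hom := by
    intro y hy
    obtain ⟨x, rfl⟩ := (c.exact y).1 hy
    exact hg' x
  refine ⟨ObjectProperty.homMk (ModuleCat.ofHom ((LinearMap.ker c.π.hom.hom).liftQ g.hom.hom hker ∘ₗ
    (c.π.hom.hom.quotKerEquivOfSurjective c.surjective).symm.toLinearMap)), ?_⟩
  ext x
  have : (c.π.hom.hom.quotKerEquivOfSurjective c.surjective).symm (c.π.hom.hom x) =
      Submodule.Quotient.mk x := by
    rw [LinearEquiv.symm_apply_eq]; simp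
  change (LinearMap.ker c.π.hom.hom).liftQ g.hom.hom hker
    ((c.π.hom.hom.quotKerEquivOfSurjective c.surjective).symm (c.π.hom.hom x)) = _
  rw [this]; rfl

lemma π_cancel {Z : FPMod R} {f g : c.S.obj ⟶ Z} (h : c.π ≫ f = c.π ≫ g) : f = g := by
  ext x
  obtain ⟨y, rfl⟩ := c.surjective x
  exact LinearMap.congr_fun (congrArg (fun f => f.hom.hom) h) y

end Cosyzygy

variable (R)

/-- A morphism of finitely presented modules factors through a projective module. -/
def FactorsThroughProj {X Y : FPMod R} (f : X ⟶ Y) : Prop :=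
  ∃ (P : FPMod R) (_ : isProj R P) (a : X ⟶ P) (b : P ⟶ Y), a ≫ b = f
variable {R}

namespace FactorsThroughProj
variable {X Y Z : FPMod R}

lemma zero : FactorsThroughProj R (0 : X ⟶ Y) :=
  ⟨⟨ModuleCat.of R PUnit.{u+1}, (inferInstance : Module.FinitePresentation R PUnit.{u+1})⟩,
    (inferInstance : Module.Projective R PUnit.{u+1}), 0, 0, by simp⟩

lemma neg {f : X ⟶ Y} (hf : FactorsThroughProj R f) : FactorsThroughProj R (-f) := by
  obtain ⟨P, hP, a, b, rfl⟩ := hf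
  exact ⟨P, hP, -a, b, by simp⟩

lemma add {f g : X ⟶ Y} (hf : FactorsThroughProj R f) (hg : FactorsThroughProj R g) :
    FactorsThroughProj R (f + g) := by
  obtain ⟨P, hP, a, b, rfl⟩ := hf
  obtain ⟨Q, hQ, a', b', rfl⟩ := hg
  have : Module.FinitePresentation R P.obj := P.property
  have : Module.FinitePresentation R Q.obj := Q.property
  have : Module.Projective R P.obj := hP
  have : Module.Projective R Q.obj := hQ
  refine ⟨⟨ModuleCat.of R (P.obj × Q.obj),
    (inferInstance : Module.FinitePresentation R (P.obj × Q.obj))⟩,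
    (inferInstance : Module.Projective R (P.obj × Q.obj)),
    ObjectProperty.homMk (ModuleCat.ofHom (a.hom.hom.prod a'.hom.hom)),
    ObjectProperty.homMk (ModuleCat.ofHom (b.hom.hom.coprod b'.hom.hom)), ?_⟩
  ext x
  change (b.hom.hom.coprod b'.hom.hom) ((a.hom.hom.prod a'.hom.hom) x) =
    b.hom.hom (a.hom.hom x) + b'.hom.hom (a'.hom.hom x)
  simp

lemma precomp {g : Y ⟶ Z} (hg : FactorsThroughProj R g) (f : X ⟶ Y) :
    FactorsThroughProj R (f ≫ g) := by
  obtain ⟨P, hP, a, b, rfl⟩ := hg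
  exact ⟨P, hP, f ≫ a, b, by simp⟩

lemma postcomp {f : X ⟶ Y} (hf : FactorsThroughProj R f) (g : Y ⟶ Z) :
    FactorsThroughProj R (f ≫ g) := by
  obtain ⟨P, hP, a, b, rfl⟩ := hf
  exact ⟨P, hP, a, b ≫ g, by simp⟩

end FactorsThroughProj

variable (R)

/-- Two morphisms of `R-Gproj` are identified in the stable category if their difference factors
through a projective module. -/
def stableRel : HomRel (Gproj R) := fun _ _ f g => FactorsThroughProj R (f.hom - g.hom)

instance : Congruence (stableRel R) where
  equivalence :=
    { refl := fun f => by simpa [stableRel] using FactorsThroughProj.zero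
      symm := fun h => by simpa [stableRel] using h.neg
      trans := fun h h' => by simpa [stableRel] using h.add h' }
  comp_left f g g' h := by
    simpa [stableRel, ← Preadditive.comp_sub] using FactorsThroughProj.precomp h f.hom
  comp_right g h := by
    simpa [stableRel, ← Preadditive.sub_comp] using FactorsThroughProj.postcomp h g.hom

/-- The stable category of `R-Gproj`: the same objects, and morphisms modulo those which factor
through projective modules. -/
abbrev StableGproj := CategoryTheory.Quotient (stableRel R)

lemma stableRel_add ⦃X Y : Gproj R⦄ (f₁ f₂ g₁ g₂ : X ⟶ Y) (h : stableRel R f₁ f₂)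
    (h' : stableRel R g₁ g₂) : stableRel R (f₁ + g₁) (f₂ + g₂) := by
  have e : (f₁ + g₁).hom - (f₂ + g₂).hom = (f₁.hom - f₂.hom) + (g₁.hom - g₂.hom) := by
    change (f₁.hom + g₁.hom) - (f₂.hom + g₂.hom) = _
    abel
  change FactorsThroughProj R ((f₁ + g₁).hom - (f₂ + g₂).hom)
  rw [e]
  exact FactorsThroughProj.add h h'

instance : Preadditive (StableGproj R) := CategoryTheory.Quotient.preadditive _ (stableRel_add R)

/-- The canonical functor from `R-Gproj` to its stable category. -/
abbrev toStable : Gproj R ⥤ StableGproj R := CategoryTheory.Quotient.functor (stableRel R)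

variable {R}
lemma exists_cosyzygy_map {X Y : Gproj R} (c : Cosyzygy X) (c' : Cosyzygy Y) (f : X ⟶ Y) :
    ∃ (h : c.S ⟶ c'.S) (g : c.I ⟶ c'.I), c.ι ≫ g = f.hom ≫ c'.ι ∧ c.π ≫ h.hom = g ≫ c'.π := by
  obtain ⟨g, hg⟩ := c.exists_ext c'.projective (f.hom ≫ c'.ι)
  obtain ⟨h, hh⟩ := c.exists_desc (g ≫ c'.π) (by rw [reassoc_of% hg, c'.ι_π, comp_zero])
  exact ⟨ObjectProperty.homMk h, g, hg, hh⟩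

lemma cosyzygy_map_unique {X Y : Gproj R} (c : Cosyzygy X) (c' : Cosyzygy Y) {f f' : X ⟶ Y}
    (hff' : stableRel R f f') {h h' : c.S ⟶ c'.S} {g g' : c.I ⟶ c'.I}
    (hg : c.ι ≫ g = f.hom ≫ c'.ι) (hh : c.π ≫ h.hom = g ≫ c'.π)
    (hg' : c.ι ≫ g' = f'.hom ≫ c'.ι) (hh' : c.π ≫ h'.hom = g' ≫ c'.π) : stableRel R h h' := by
  obtain ⟨P, hP, a, b, hab⟩ := hff'
  obtain ⟨a', rfl⟩ := c.exists_ext hP a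
  obtain ⟨k, hk⟩ := c.exists_desc (g - g' - a' ≫ b ≫ c'.ι) (by
    rw [Preadditive.comp_sub, Preadditive.comp_sub, hg, hg', ← Preadditive.sub_comp, ← hab]
    simp)
  refine ⟨c'.I, c'.projective, k, c'.π, c.π_cancel ?_⟩
  rw [reassoc_of% hk, Preadditive.comp_sub, hh, hh', ← Preadditive.sub_comp]
  simp [Preadditive.sub_comp, c'.ι_π]

/-- For `f : X ⟶ Y`, a morphism `S(X) ⟶ S(Y)` induced by an extension `I(X) ⟶ I(Y)` of `f`. -/
noncomputable def cosyzygyMap {X Y : Gproj R} (f : X ⟶ Y) :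
    (cosyzygy X).S ⟶ (cosyzygy Y).S :=
  (exists_cosyzygy_map (cosyzygy X) (cosyzygy Y) f).choose

lemma cosyzygyMap_spec {X Y : Gproj R} (f : X ⟶ Y) :
    ∃ g : (cosyzygy X).I ⟶ (cosyzygy Y).I, (cosyzygy X).ι ≫ g = f.hom ≫ (cosyzygy Y).ι ∧
      (cosyzygy X).π ≫ (cosyzygyMap f).hom = g ≫ (cosyzygy Y).π :=
  (exists_cosyzygy_map (cosyzygy X) (cosyzygy Y) f).choose_spec

variable (R)

/-- The suspension functor of the stable category: it sends `X` to `S(X)`, where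
`0 ⟶ X ⟶ I(X) ⟶ S(X) ⟶ 0` is the chosen conflation, and a morphism to the induced one. -/
noncomputable def stableSuspension : StableGproj R ⥤ StableGproj R :=
  CategoryTheory.Quotient.lift _
    { obj := fun X => (toStable R).obj (cosyzygy X).S
      map := fun f => (toStable R).map (cosyzygyMap f)
      map_id := fun X => by
        obtain ⟨g, hg, hh⟩ := cosyzygyMap_spec (𝟙 X)
        exact (CategoryTheory.Quotient.sound _ (cosyzygy_map_unique _ _
          (Congruence.equivalence.refl (𝟙 X)) hg hh (h' := 𝟙 _) (g' := 𝟙 _)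
          (by simp) (by simp))).trans ((toStable R).map_id _)
      map_comp := fun {X Y Z} f f' => by
        obtain ⟨g, hg, hh⟩ := cosyzygyMap_spec (f ≫ f')
        obtain ⟨g₁, hg₁, hh₁⟩ := cosyzygyMap_spec f
        obtain ⟨g₂, hg₂, hh₂⟩ := cosyzygyMap_spec f'
        rw [← Functor.map_comp]
        exact CategoryTheory.Quotient.sound _ (cosyzygy_map_unique _ _
          (Congruence.equivalence.refl (f ≫ f')) hg hh (g' := g₁ ≫ g₂)
          (by simp [reassoc_of% hg₁, hg₂]) (by simp [reassoc_of% hh₁, hh₂])) }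
    (fun X Y f f' h => by
      obtain ⟨g₁, hg₁, hh₁⟩ := cosyzygyMap_spec f
      obtain ⟨g₂, hg₂, hh₂⟩ := cosyzygyMap_spec f'
      exact CategoryTheory.Quotient.sound _ (cosyzygy_map_unique _ _ h hg₁ hh₁ hg₂ hh₂))
end

section
variable (R : Type u) [Ring R] [IsLeftCoherentRing R]
open DerivedCategory Pretriangulated ZeroObject

/-- The derived category of `R-mod` is the standard localization of the category of complexes. -/
noncomputable instance : HasDerivedCategory.{u + 1} (FPMod R) := HasDerivedCategory.standard _

/-- The perfect complexes: the objects of the derived category of `R-mod` which are isomorphic to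
a bounded complex of finitely generated projective modules. -/
def isPerfect : ObjectProperty (DerivedCategory (FPMod R)) := fun X =>
  ∃ K : CochainComplex (FPMod R) ℤ, (∃ a : ℤ, K.IsStrictlyGE a) ∧ (∃ b : ℤ, K.IsStrictlyLE b) ∧
    (∀ i, isProj R (K.X i)) ∧ Nonempty (X ≅ Q.obj K)

instance : (isPerfect R).IsClosedUnderIsomorphisms where
  of_iso := by
    rintro X Y e ⟨K, ha, hb, hK, ⟨e'⟩⟩
    exact ⟨K, ha, hb, hK, ⟨e.symm ≪≫ e'⟩⟩

variable {R} in
lemma isPerfect_single {P : FPMod R} (hP : isProj R P) :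
    isPerfect R ((singleFunctor (FPMod R) 0).obj P) := by
  refine ⟨(HomologicalComplex.single _ _ 0).obj P, ⟨0, inferInstance⟩, ⟨0, inferInstance⟩,
    fun i => ?_, ⟨Iso.refl _⟩⟩
  by_cases hi : i = 0
  · subst hi
    exact (isProj_iff _).2 (Projective.of_iso
      (HomologicalComplex.singleObjXSelf (ComplexShape.up ℤ) 0 P).symm ((isProj_iff _).1 hP))
  · exact (isProj_iff _).2
      (HomologicalComplex.isZero_single_obj_X (ComplexShape.up ℤ) 0 P i hi).projective

instance : (isPerfect R).ContainsZero where
  exists_zero := ⟨_, (singleFunctor (FPMod R) 0).map_isZero (isZero_zero _),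
    isPerfect_single ((isProj_iff _).2 (isZero_zero (FPMod R)).projective)⟩

instance : (isPerfect R).IsStableUnderShift ℤ where
  isStableUnderShiftBy n :=
    { le_shift := by
        rintro X ⟨K, ⟨a, ha⟩, ⟨b, hb⟩, hK, ⟨e⟩⟩
        exact ⟨K⟦n⟧, ⟨a - n, K.isStrictlyGE_shift a n _ (by lia)⟩,
          ⟨b - n, K.isStrictlyLE_shift b n _ (by lia)⟩, fun i => hK (i + n),
          ⟨(shiftFunctor _ n).mapIso e ≪≫ (Q.commShiftIso n).symm.app K⟩⟩ }

variable {R} in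
lemma isPerfect_mappingCone {K L : CochainComplex (FPMod R) ℤ} (f : K ⟶ L)
    (haK : ∃ a : ℤ, K.IsStrictlyGE a) (hbK : ∃ b : ℤ, K.IsStrictlyLE b)
    (hK : ∀ i, isProj R (K.X i)) (haL : ∃ a : ℤ, L.IsStrictlyGE a)
    (hbL : ∃ b : ℤ, L.IsStrictlyLE b) (hL : ∀ i, isProj R (L.X i)) :
    isPerfect R (Q.obj (CochainComplex.mappingCone f)) := by
  obtain ⟨a, ha⟩ := haK
  obtain ⟨b, hb⟩ := hbK
  obtain ⟨a', ha'⟩ := haL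
  obtain ⟨b', hb'⟩ := hbL
  refine ⟨_, ⟨min (a - 1) a', ?_⟩, ⟨max (b - 1) b', ?_⟩, fun i => ?_, ⟨Iso.refl _⟩⟩
  · rw [CochainComplex.isStrictlyGE_iff]
    intro i hi
    rw [CochainComplex.mappingCone.isZero_X_iff]
    exact ⟨K.isZero_of_isStrictlyGE a _ (by lia), L.isZero_of_isStrictlyGE a' _ (by lia)⟩
  · rw [CochainComplex.isStrictlyLE_iff]
    intro i hi
    rw [CochainComplex.mappingCone.isZero_X_iff]
    exact ⟨K.isZero_of_isStrictlyLE b _ (by lia), L.isZero_of_isStrictlyLE b' _ (by lia)⟩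
  · have h1 := (isProj_iff _).1 (hK (i + 1))
    have h2 := (isProj_iff _).1 (hL i)
    exact (isProj_iff _).2 (Projective.of_iso
      (HomologicalComplex.homotopyCofiber.XIsoBiprod f i (i + 1) rfl).symm inferInstance)

variable {R} in
lemma exists_Q_map_eq {K L : CochainComplex (FPMod R) ℤ} (hbK : ∃ b : ℤ, K.IsStrictlyLE b)
    (hK : ∀ i, isProj R (K.X i)) (f : Q.obj K ⟶ Q.obj L) : ∃ g : K ⟶ L, Q.map g = f := by
  obtain ⟨b, hb⟩ := hbK
  have := fun i => (isProj_iff _).1 (hK i)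
  have := CochainComplex.isKProjective_of_projective K b
  obtain ⟨g, hg⟩ := (CochainComplex.IsKProjective.Qh_map_bijective K
    ((HomotopyCategory.quotient _ _).obj L)).surjective
    ((quotientCompQhIso _).hom.app K ≫ f ≫ (quotientCompQhIso _).inv.app L)
  obtain ⟨g, rfl⟩ := (HomotopyCategory.quotient _ _).map_surjective g
  refine ⟨g, ?_⟩
  rw [← cancel_epi ((quotientCompQhIso _).hom.app K), ← quotientCompQhIso_hom_naturality g, hg]
  simp

instance : (isPerfect R).IsTriangulatedClosed₃ := .mk' (by
  rintro T hT ⟨K, haK, hbK, hK, ⟨e⟩⟩ ⟨L, haL, hbL, hL, ⟨e'⟩⟩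
  obtain ⟨f, hf⟩ := exists_Q_map_eq hbK hK (e.inv ≫ T.mor₁ ≫ e'.hom)
  have h : T.mor₁ ≫ e'.hom = e.hom ≫ Q.map f := by rw [hf, e.hom_inv_id_assoc]
  exact (isPerfect R).prop_of_iso (Triangle.π₃.mapIso (isoTriangleOfIso₁₂ _ _ hT
    (mappingCone_triangle_distinguished f) e e' h)).symm
    (isPerfect_mappingCone f haK hbK hK haL hbL hL))

instance : (isPerfect R).IsTriangulated where
  toIsTriangulatedClosed₂ := .of_isTriangulatedClosed₃

/-- The perfect complexes as objects of the bounded derived category of `R-mod`. -/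
def isPerfectBounded : ObjectProperty (Bounded (FPMod R)) := (isPerfect R).inverseImage Bounded.ι

instance : (isPerfectBounded R).IsTriangulated := by
  dsimp only [isPerfectBounded]; infer_instance
instance : (isPerfectBounded R).IsClosedUnderIsomorphisms := by
  dsimp only [isPerfectBounded]; infer_instance

/-- The singularity category `D_sg(R)`: the Verdier quotient of the bounded derived category of
`R-mod` by the perfect complexes, obtained by inverting the morphisms whose cone is perfect.
Mathlib provides its triangulated structure. -/
abbrev Dsg := (isPerfectBounded R).trW.Localization

/-- The quotient functor from the bounded derived category to `D_sg(R)`. -/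
noncomputable abbrev toDsg : Bounded (FPMod R) ⥤ Dsg R := (isPerfectBounded R).trW.Q

/-- The functor sending a finitely presented module to the stalk complex in degree zero. -/
noncomputable def stalk : FPMod R ⥤ Bounded (FPMod R) :=
  ObjectProperty.lift _ (singleFunctor (FPMod R) 0) (fun X =>
    ⟨⟨0, inferInstanceAs (((singleFunctor (FPMod R) 0).obj X).IsGE 0)⟩, ⟨0, inferInstance⟩⟩)

instance : (stalk R).Additive where
  map_add {X Y f g} := by
    apply (Bounded.ι).map_injective
    exact (singleFunctor (FPMod R) 0).map_add

/-- The composite `R-Gproj ⟶ R-mod ⟶ D^b(R-mod) ⟶ D_sg(R)`. -/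
noncomputable def GprojToDsg : Gproj R ⥤ Dsg R := (isGorensteinProjective R).ι ⋙ stalk R ⋙ toDsg R

lemma isZero_toDsg_stalk (P : FPMod R) (hP : isProj R P) :
    IsZero ((toDsg R).obj ((stalk R).obj P)) := by
  have h : isPerfectBounded R ((stalk R).obj P) := isPerfect_single hP
  have : IsIso ((toDsg R).map (0 : 0 ⟶ (stalk R).obj P)) :=
    Localization.inverts (toDsg R) (isPerfectBounded R).trW _
      (ObjectProperty.trW.mk _ (contractible_distinguished₁ ((stalk R).obj P)) h)
  exact ((toDsg R).map_isZero (isZero_zero _)).of_iso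
    (asIso ((toDsg R).map (0 : 0 ⟶ (stalk R).obj P))).symm

/-- The functor `Φ_R` from the stable category of `R-Gproj` to `D_sg(R)` induced by the composite
`R-Gproj ⟶ R-mod ⟶ D^b(R-mod) ⟶ D_sg(R)`. -/
noncomputable def Phi : StableGproj R ⥤ Dsg R := CategoryTheory.Quotient.lift _ (GprojToDsg R) (by
  rintro X Y f g ⟨P, hP, a, b, h⟩
  have h0 : (toDsg R).map ((stalk R).map (f.hom - g.hom)) = 0 := by
    rw [← h, Functor.map_comp, Functor.map_comp, (isZero_toDsg_stalk R P hP).eq_of_tgt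
      ((toDsg R).map ((stalk R).map a)) 0, zero_comp]
  rw [Functor.map_sub, Functor.map_sub, sub_eq_zero] at h0
  exact h0)

variable {R} in
/-- The standard triangles `X ⟶ Y ⟶ Z ⟶ S(X)`: `Z` is the pushout of `u : X ⟶ Y` along
`X ⟶ I(X)`, and `w : Z ⟶ S(X)` is induced by zero on `Y` and by `I(X) ⟶ S(X)`. -/
def IsStandardTriangle {X Y Z : Gproj R} (u : X ⟶ Y) (v : Y ⟶ Z) (w : Z ⟶ (cosyzygy X).S) : Prop :=
  ∃ j : (cosyzygy X).I ⟶ Z.obj,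
    IsPushout u.hom (cosyzygy X).ι v.hom j ∧ v.hom ≫ w.hom = 0 ∧ j ≫ w.hom = (cosyzygy X).π

variable {R} in
/-- The exact triangles of the stable category: those isomorphic to the image of a standard
triangle. -/
def IsExactTriangle {X Y Z : StableGproj R} (u : X ⟶ Y) (v : Y ⟶ Z)
    (w : Z ⟶ (stableSuspension R).obj X) : Prop :=
  ∃ (X' Y' Z' : Gproj R) (u' : X' ⟶ Y') (v' : Y' ⟶ Z') (w' : Z' ⟶ (cosyzygy X').S)
    (a : X ≅ (toStable R).obj X') (b : Y ≅ (toStable R).obj Y') (c : Z ≅ (toStable R).obj Z'),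
    IsStandardTriangle u' v' w' ∧ u ≫ b.hom = a.hom ≫ (toStable R).map u' ∧
    v ≫ c.hom = b.hom ≫ (toStable R).map v' ∧
    w ≫ (stableSuspension R).map a.hom = c.hom ≫ (toStable R).map w'

/-- `F` is a triangle functor from the stable category to `D_sg(R)`: it is additive and there is
a natural isomorphism `F Σ ≅ Σ F` through which `F` sends exact triangles to exact triangles. -/
def IsTriangleFunctor (F : StableGproj R ⥤ Dsg R) : Prop :=
  F.Additive ∧ ∃ η : stableSuspension R ⋙ F ≅ F ⋙ shiftFunctor (Dsg R) (1 : ℤ),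
    ∀ ⦃X Y Z : StableGproj R⦄ (u : X ⟶ Y) (v : Y ⟶ Z) (w : Z ⟶ (stableSuspension R).obj X),
      IsExactTriangle u v w →
        Triangle.mk (F.map u) (F.map v) (F.map w ≫ η.hom.app X) ∈ distTriang (Dsg R)

/-- `F` is dense up to direct summands: each object of `D_sg(R)` is a direct summand of an object
in the image of `F`. -/
def DenseUpToSummands (F : StableGproj R ⥤ Dsg R) : Prop :=
  ∀ X : Dsg R, ∃ (G : StableGproj R) (Y : Dsg R), Nonempty (F.obj G ≅ X ⊞ Y)

end

section
variable (R : Type u) [Ring R]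

variable {R} in
/-- `Gpd_R(M) ≤ n`: there is an exact sequence `0 ⟶ Gₙ ⟶ ⋯ ⟶ G₁ ⟶ G₀ ⟶ M ⟶ 0` of finitely
presented modules with each `Gᵢ` Gorenstein projective (written as a resolution which is zero
beyond degree `n`). -/
def GpdLE (M : FPMod R) (n : ℕ) : Prop :=
  ∃ (G : ChainComplex (FPMod R) ℕ) (ε : G.X 0 ⟶ M),
    (∀ i, isGorensteinProjective R (G.X i)) ∧ (∀ i, n < i → IsZero (G.X i)) ∧
    Function.Surjective ε.hom.hom ∧ Function.Exact (G.d 1 0).hom.hom ε.hom.hom ∧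
    ∀ i, Function.Exact (G.d (i + 2) (i + 1)).hom.hom (G.d (i + 1) i).hom.hom

/-- `R` is left G-regular: each finitely presented left `R`-module has finite Gorenstein
projective dimension. -/
def IsLeftGRegular : Prop := ∀ M : FPMod R, ∃ n : ℕ, GpdLE M n

end

end SingCat

/-! The finitely presented Gorenstein projective modules form the largest class of modules `X` with
`Extⁿ(X, Q) = 0` for `n > 0` and `Q` projective that is closed under taking cosyzygies, i.e.
cokernels of suitable embeddings into projective modules.

The vanishing of `Ext` implies, by peeling off the lowest term of a perfect complex, that a morphism
in the derived category from a Gorenstein projective module to a perfect complex factors through a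
perfect complex in nonnegative degrees, on which a morphism to a module factors through a projective
module. Hence every fraction between Gorenstein projective modules is represented by a homomorphism,
unique up to homomorphisms factoring through projective modules. Projective modules vanish in
`D_sg(R)`, so the connecting morphism of `0 ⟶ X ⟶ I(X) ⟶ ΣX ⟶ 0` is an isomorphism there, and it
makes `Φ_R` a triangle functor.

If `M` is a retract in `D_sg(R)` of a Gorenstein projective module, then `Extⁿ(M, Q) = 0` for large
`n`. Passing to syzygies we may assume that this holds for all `n > 0`; then `M` is a retract of a
Gorenstein projective module already as a module, up to a projective summand, hence Gorenstein
projective. Conversely, the essential image of `Φ_R` is a triangulated subcategory. If `R` is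
G-regular, it contains all modules, hence, by dévissage along brutal truncations, all objects. -/

namespace SingCat

/-! ### Vanishing of `Ext` -/

section
universe w
open Abelian
variable {A : Type*} [Category* A] [Abelian A] [HasExt.{w} A]

/-- The objects `X` with `Extⁿ(X, Q) = 0` for all projective `Q` and all `n > m`. -/
def ExtVanishAbove (m : ℕ) : ObjectProperty A := fun X =>
  ∀ (Q : A) [Projective Q] (n : ℕ), m < n → Subsingleton (Ext X Q n)

lemma ExtVanishAbove.of_le {m m' : ℕ} {X : A} (hX : ExtVanishAbove m X) (h : m ≤ m') :
    ExtVanishAbove m' X :=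
  fun Q _ n hn => hX Q n (by lia)

lemma ExtVanishAbove.of_projective {P : A} [Projective P] : ExtVanishAbove 0 P := by
  rintro Q _ (_ | n) hn
  · lia
  · exact Ext.subsingleton_of_projective P Q n

instance (m : ℕ) : (ExtVanishAbove m : ObjectProperty A).IsStableUnderRetracts where
  of_retract {X Y} r hY Q _ n hn := subsingleton_of_forall_eq 0 fun α => by
    have := hY Q n hn
    rw [← Ext.mk₀_id_comp α, ← r.retract, ← Ext.mk₀_comp_mk₀_assoc,
      Subsingleton.elim ((Ext.mk₀ r.r).comp α (zero_add n)) 0, Ext.comp_zero]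

instance (m : ℕ) : (ExtVanishAbove m : ObjectProperty A).IsClosedUnderExtensions where
  prop_X₂_of_shortExact {S} hS h₁ h₃ Q _ n hn := subsingleton_of_forall_eq 0 fun α => by
    have := h₁ Q n hn
    have := h₃ Q n hn
    obtain ⟨β, rfl⟩ := Ext.contravariant_sequence_exact₂ hS Q α (Subsingleton.elim _ _)
    rw [Subsingleton.elim β 0, Ext.comp_zero]

section
variable {S : ShortComplex A} (hS : S.ShortExact)
include hS

lemma ExtVanishAbove.syzygy [Projective S.X₂] {m : ℕ} (h : ExtVanishAbove (m + 1) S.X₃) :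
    ExtVanishAbove m S.X₁ := fun Q _ n hn => subsingleton_of_forall_eq 0 fun α => by
  have := h Q (1 + n) (by lia)
  have := ExtVanishAbove.of_projective (P := S.X₂) Q n (by lia)
  obtain ⟨β, rfl⟩ := Ext.contravariant_sequence_exact₁ hS Q α rfl (Subsingleton.elim _ _)
  rw [Subsingleton.elim β 0, Ext.comp_zero]

lemma ExtVanishAbove.exists_extension (h : ExtVanishAbove 0 S.X₃) {Q : A} [Projective Q]
    (f : S.X₁ ⟶ Q) : ∃ g : S.X₂ ⟶ Q, S.f ≫ g = f := by
  have := h Q 1 one_pos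
  obtain ⟨β, hβ⟩ := Ext.contravariant_sequence_exact₁ hS Q (Ext.mk₀ f) (add_zero 1)
    (Subsingleton.elim _ _)
  obtain ⟨g, rfl⟩ := (Ext.mk₀_bijective _ _).2 β
  exact ⟨g, (Ext.mk₀_bijective _ _).1 (by rw [← hβ, Ext.mk₀_comp_mk₀])⟩

lemma subsingleton_ext_succ_of_surjective [Projective S.X₂] {Y : A} (n : ℕ)
    (h : Function.Surjective fun β : Ext S.X₂ Y n => (Ext.mk₀ S.f).comp β (zero_add n)) :
    Subsingleton (Ext S.X₃ Y (n + 1)) := subsingleton_of_forall_eq 0 fun α => by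
  obtain ⟨β, rfl⟩ := Ext.contravariant_sequence_exact₃ hS Y α (Ext.eq_zero_of_projective _)
    (add_comm 1 n)
  obtain ⟨γ, rfl⟩ := h β
  rw [← Ext.comp_assoc hS.extClass _ γ (add_zero 1) (zero_add n) (by lia), hS.extClass_comp,
    Ext.zero_comp]

end

lemma le_extVanishAbove_zero {S : ObjectProperty A}
    (h : ∀ X, S X → ∃ T : ShortComplex A, T.ShortExact ∧ T.X₃ = X ∧ Projective T.X₂ ∧ S T.X₁ ∧
      ∀ (Q : A) [Projective Q] (f : T.X₁ ⟶ Q), ∃ g, T.f ≫ g = f) :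
    S ≤ ExtVanishAbove 0 := by
  suffices ∀ (n : ℕ) (X : A), S X → ∀ (Q : A) [Projective Q], Subsingleton (Ext X Q (n + 1)) by
    rintro X hX Q _ (_ | n) hn
    · lia
    · exact this n X hX Q
  intro n
  induction n with
  | zero =>
    intro X hX Q _
    obtain ⟨T, hT, rfl, _, -, hext⟩ := h X hX
    refine subsingleton_ext_succ_of_surjective hT 0 fun α => ?_
    obtain ⟨f, rfl⟩ := (Ext.mk₀_bijective _ _).2 α
    obtain ⟨g, rfl⟩ := hext Q f
    exact ⟨Ext.mk₀ g, Ext.mk₀_comp_mk₀ _ _⟩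
  | succ n ih =>
    intro X hX Q _
    obtain ⟨T, hT, rfl, _, hK, -⟩ := h X hX
    have := ih _ hK Q
    exact subsingleton_ext_succ_of_surjective hT (n + 1) fun α => ⟨0, Subsingleton.elim _ _⟩

end

/-! ### Gorenstein projective objects -/

section
variable {A : Type*} [Category* A] [Abelian A]

lemma shortExact_cokernel {S₁ S₂ : ShortComplex A} (h₁ : S₁.ShortExact) (h₂ : S₂.ShortExact)
    (φ : S₁ ⟶ S₂) [Mono φ.τ₃] : (cokernel φ).ShortExact := by
  let T : ShortComplex.SnakeInput A :=
    { L₀ := kernel φ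
      L₁ := S₁
      L₂ := S₂
      L₃ := cokernel φ
      v₀₁ := kernel.ι φ
      v₁₂ := φ
      v₂₃ := cokernel.π φ
      h₀ := kernelIsKernel φ
      h₃ := cokernelIsCokernel φ
      L₁_exact := h₁.exact
      epi_L₁_g := h₁.epi_g
      L₂_exact := h₂.exact
      mono_L₂_f := h₂.mono_f }
  have : Epi T.L₂.g := h₂.epi_g
  have : Mono T.v₁₂.τ₃ := ‹_›
  have : Mono T.v₀₁.τ₃ := T.mono_v₀₁_τ₃
  have hX : IsZero T.L₀.X₃ := IsZero.of_mono_eq_zero T.v₀₁.τ₃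
    (by rw [← cancel_mono T.v₁₂.τ₃, zero_comp, T.w₀₂_τ₃])
  exact { exact := T.L₃_exact
          mono_f := T.L₂'_exact.mono_g (hX.eq_of_src _ _)
          epi_g := T.epi_L₃_g }

/-- The embeddings of the horseshoe lemma. -/
lemma exists_mono_biprod {S : ShortComplex A} (hS : S.ShortExact) {P₁ P₃ : A} (i₁ : S.X₁ ⟶ P₁)
    (i₃ : S.X₃ ⟶ P₃) [Mono i₁] [Mono i₃] (j : S.X₂ ⟶ P₁) (hj : S.f ≫ j = i₁) :
    ∃ (i₂ : S.X₂ ⟶ P₁ ⊞ P₃) (T : ShortComplex A), Mono i₂ ∧ T.ShortExact ∧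
      Nonempty (T.X₁ ≅ cokernel i₁) ∧ Nonempty (T.X₂ ≅ cokernel i₂) ∧
      Nonempty (T.X₃ ≅ cokernel i₃) := by
  have hT := (ShortComplex.Splitting.ofHasBinaryBiproduct P₁ P₃).shortExact
  let φ : S ⟶ ShortComplex.mk (biprod.inl : P₁ ⟶ P₁ ⊞ P₃) biprod.snd biprod.inl_snd :=
    { τ₁ := i₁
      τ₂ := biprod.lift j (S.g ≫ i₃)
      τ₃ := i₃
      comm₁₂ := by ext <;> simp [hj] }
  have : Mono φ.τ₁ := ‹_›
  have : Mono φ.τ₃ := ‹_›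
  have := hS.mono_f
  have := hT.mono_f
  exact ⟨φ.τ₂, cokernel φ, ShortComplex.mono_τ₂_of_exact_of_mono φ hS.exact,
    shortExact_cokernel hS hT φ, ⟨PreservesCokernel.iso ShortComplex.π₁ φ⟩,
    ⟨PreservesCokernel.iso ShortComplex.π₂ φ⟩, ⟨PreservesCokernel.iso ShortComplex.π₃ φ⟩⟩

lemma exists_shortExact_of_retract {X G P : A} (r : Retract X G) (ι : G ⟶ P) [Mono ι] :
    ∃ (f : G ⟶ cokernel (r.i ≫ ι) ⊞ X) (g : cokernel (r.i ≫ ι) ⊞ X ⟶ cokernel ι) (w : f ≫ g = 0),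
      (ShortComplex.mk f g w).ShortExact := by
  let π := cokernel.π (r.i ≫ ι)
  let q : cokernel (r.i ≫ ι) ⟶ cokernel ι := cokernel.desc _ (cokernel.π ι) (by simp)
  have hπ : r.i ≫ ι ≫ π = 0 := by rw [← Category.assoc, cokernel.condition]
  have hq : π ≫ q = cokernel.π ι := cokernel.π_desc _ _ _
  have : Epi q := epi_of_epi_fac hq
  refine ⟨biprod.lift (ι ≫ π) r.r, biprod.fst ≫ q, by simp [hq],
    { exact := ?_, mono_f := Preadditive.mono_of_cancel_zero _ fun t ht => ?_,
      epi_g := epi_comp _ _ }⟩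
  · rw [ShortComplex.exact_iff_exact_up_to_refinements]
    intro T (y : T ⟶ _ ⊞ X) (hy : y ≫ biprod.fst ≫ q = 0)
    obtain ⟨T', ρ, hρ, c, hc⟩ := surjective_up_to_refinements_of_epi π (y ≫ biprod.fst)
    have hcι : c ≫ cokernel.π ι = 0 := by rw [← hq, ← reassoc_of% hc, hy, comp_zero]
    obtain ⟨s, rfl⟩ : ∃ s, s ≫ ι = c :=
      ⟨_, (ShortComplex.exact_cokernel ι).lift_f c hcι⟩
    refine ⟨T', ρ, hρ, s + (ρ ≫ y ≫ biprod.snd - s ≫ r.r) ≫ r.i, ?_⟩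
    apply biprod.hom_ext
    · simpa [hπ] using hc
    · simp
  · obtain ⟨s, hs⟩ : ∃ s, s ≫ r.i ≫ ι = t ≫ ι :=
      ⟨_, (ShortComplex.exact_cokernel (r.i ≫ ι)).lift_f (t ≫ ι)
        (by simpa [π] using ht =≫ biprod.fst)⟩
    obtain rfl : s ≫ r.i = t := by rw [← cancel_mono ι, Category.assoc, hs]
    obtain rfl : s = 0 := by simpa using ht =≫ biprod.snd
    exact zero_comp

end

section
universe w
variable {A : Type*} [Category* A] [Abelian A]

/-- The objects which embed into a projective object with cokernel in `S`. -/
def HasCosyzygyIn (S : ObjectProperty A) : ObjectProperty A := fun X =>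
  ∃ (P : A) (i : X ⟶ P), Mono i ∧ Projective P ∧ S (cokernel i)

lemma monotone_hasCosyzygyIn : Monotone (HasCosyzygyIn (A := A)) :=
  fun _ _ h _ ⟨P, i, hi, hP, hZ⟩ => ⟨P, i, hi, hP, h _ hZ⟩

instance (S : ObjectProperty A) [S.IsClosedUnderIsomorphisms] :
    (HasCosyzygyIn S).IsClosedUnderIsomorphisms where
  of_iso := fun e ⟨P, i, _, hP, hZ⟩ => ⟨P, e.inv ≫ i, mono_comp _ _, hP,
    S.prop_of_iso (cokernelEpiComp e.inv i).symm hZ⟩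

lemma HasCosyzygyIn.of_shortExact {S : ObjectProperty A} [S.IsClosedUnderIsomorphisms]
    {T : ShortComplex A} (hT : T.ShortExact) [Projective T.X₂] (h : S T.X₃) :
    HasCosyzygyIn S T.X₁ :=
  ⟨T.X₂, T.f, hT.mono_f, ‹_›, S.prop_of_iso
    (hT.gIsCokernel.coconePointUniqueUpToIso (colimit.isColimit _)) h⟩

variable [HasExt.{w} A]

/-- A class of objects `X` with `Extⁿ(X, Q) = 0` for `Q` projective and `n > 0` which embed into
projective objects with cokernel in the class. -/
structure IsCosyzygyClosed (S : ObjectProperty A) : Prop where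
  ext : S ≤ ExtVanishAbove 0
  cosyzygy : S ≤ HasCosyzygyIn S

/-- The Gorenstein projective objects of an abelian category: those obtained by iterating the
formation of cosyzygies. This is the largest class which is closed under cosyzygies. -/
def gorensteinProjective : ObjectProperty A := fun X => ∃ S, IsCosyzygyClosed S ∧ S X

lemma IsCosyzygyClosed.le {S : ObjectProperty A} (hS : IsCosyzygyClosed S) :
    S ≤ gorensteinProjective := fun _ hX => ⟨S, hS, hX⟩

lemma isCosyzygyClosed_gorensteinProjective :
    IsCosyzygyClosed (gorensteinProjective : ObjectProperty A) where
  ext X := fun ⟨_, hS, hX⟩ => hS.ext X hX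
  cosyzygy X := fun ⟨_, hS, hX⟩ => monotone_hasCosyzygyIn hS.le X (hS.cosyzygy X hX)

lemma gorensteinProjective.extVanishAbove {X : A} (hX : gorensteinProjective X) :
    ExtVanishAbove 0 X := isCosyzygyClosed_gorensteinProjective.ext X hX

lemma gorensteinProjective.hasCosyzygyIn {X : A} (hX : gorensteinProjective X) :
    HasCosyzygyIn gorensteinProjective X := isCosyzygyClosed_gorensteinProjective.cosyzygy X hX

instance : (gorensteinProjective : ObjectProperty A).IsClosedUnderIsomorphisms where
  of_iso e := fun ⟨S, hS, hX⟩ => by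
    refine IsCosyzygyClosed.le (S := S.isoClosure) ⟨?_, ?_⟩ _ ⟨_, hX, ⟨e.symm⟩⟩
    · exact ObjectProperty.isoClosure_le_iff _ _ |>.2 hS.ext
    · exact ObjectProperty.isoClosure_le_iff _ _ |>.2
        (hS.cosyzygy.trans (monotone_hasCosyzygyIn S.le_isoClosure))

lemma gorensteinProjective.of_projective {P : A} [Projective P] : gorensteinProjective P := by
  refine IsCosyzygyClosed.le (S := fun P => Projective P) ⟨fun P _ => .of_projective, ?_⟩ P ‹_›
  exact fun P hP => ⟨P, 𝟙 P, inferInstance, hP, (isZero_cokernel_of_epi (𝟙 P)).projective⟩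

lemma gorensteinProjective.of_hasCosyzygyIn {X : A} (hX : HasCosyzygyIn gorensteinProjective X) :
    gorensteinProjective X := by
  refine IsCosyzygyClosed.le ⟨?_, monotone_hasCosyzygyIn fun X hX => hX.hasCosyzygyIn⟩ X hX
  rintro X ⟨P, i, _, hP, hZ⟩
  let T := ShortComplex.mk i (cokernel.π i) (cokernel.condition i)
  have hT : T.ShortExact := { exact := ShortComplex.exact_cokernel i }
  have : Projective T.X₂ := hP
  exact .syzygy hT (hZ.extVanishAbove.of_le zero_le_one)

lemma gorensteinProjective.syzygy {S : ShortComplex A} (hS : S.ShortExact) [Projective S.X₂]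
    (h : gorensteinProjective S.X₃) : gorensteinProjective S.X₁ :=
  .of_hasCosyzygyIn (.of_shortExact hS h)

/-- The objects which are extensions of objects in `S`. -/
def IsExtensionOf (S : ObjectProperty A) : ObjectProperty A := fun X =>
  ∃ T : ShortComplex A, T.ShortExact ∧ S T.X₁ ∧ S T.X₃ ∧ Nonempty (T.X₂ ≅ X)

instance (S : ObjectProperty A) : (IsExtensionOf S).IsClosedUnderIsomorphisms where
  of_iso := fun e ⟨T, hT, h₁, h₃, ⟨e'⟩⟩ => ⟨T, hT, h₁, h₃, ⟨e' ≪≫ e⟩⟩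

lemma isCosyzygyClosed_isExtensionOf_gorensteinProjective :
    IsCosyzygyClosed (IsExtensionOf gorensteinProjective : ObjectProperty A) where
  ext := by
    rintro X ⟨T, hT, h₁, h₃, ⟨e⟩⟩
    exact (ExtVanishAbove 0).prop_of_iso e ((ExtVanishAbove 0).prop_X₂_of_shortExact hT
      h₁.extVanishAbove h₃.extVanishAbove)
  cosyzygy := by
    rintro X ⟨T, hT, h₁, h₃, ⟨e⟩⟩
    refine ObjectProperty.prop_of_iso _ e ?_
    obtain ⟨P₁, i₁, _, _, hZ₁⟩ := h₁.hasCosyzygyIn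
    obtain ⟨P₃, i₃, _, _, hZ₃⟩ := h₃.hasCosyzygyIn
    obtain ⟨j, hj⟩ := h₃.extVanishAbove.exists_extension hT i₁
    obtain ⟨i₂, T', hi₂, hT', ⟨e₁⟩, e₂, ⟨e₃⟩⟩ := exists_mono_biprod hT i₁ i₃ j hj
    exact ⟨P₁ ⊞ P₃, i₂, hi₂, inferInstance, T', hT', ObjectProperty.prop_of_iso _ e₁.symm hZ₁,
      ObjectProperty.prop_of_iso _ e₃.symm hZ₃, e₂⟩

instance : (gorensteinProjective : ObjectProperty A).IsClosedUnderExtensions where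
  prop_X₂_of_shortExact {T} hT h₁ h₃ :=
    isCosyzygyClosed_isExtensionOf_gorensteinProjective.le T.X₂ ⟨T, hT, h₁, h₃, ⟨Iso.refl _⟩⟩

instance : (gorensteinProjective : ObjectProperty A).IsStableUnderRetracts where
  of_retract {X Y} r hY := by
    refine IsCosyzygyClosed.le (S := gorensteinProjective.retractClosure) ⟨?_, ?_⟩ X ⟨Y, hY, ⟨r⟩⟩
    · rintro X ⟨G, hG, ⟨r⟩⟩
      exact (ExtVanishAbove 0).prop_of_retract r hG.extVanishAbove
    · rintro X ⟨G, hG, ⟨r⟩⟩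
      obtain ⟨P, ι, _, hP, hZ⟩ := hG.hasCosyzygyIn
      obtain ⟨f, g, w, hT⟩ := exists_shortExact_of_retract r ι
      have := gorensteinProjective.prop_X₂_of_shortExact hT hG hZ
      exact ⟨P, r.i ≫ ι, mono_comp _ _, hP, _, this, ⟨biprod.inl, biprod.fst, biprod.inl_fst⟩⟩

end

lemma exists_int_chain {α : Type*} (r : α → α → Prop) (h₁ : ∀ a, ∃ b, r a b)
    (h₂ : ∀ b, ∃ a, r a b) (a : α) (m : ℤ) :
    ∃ x : ℤ → α, x m = a ∧ ∀ n, r (x n) (x (n + 1)) := by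
  choose f hf using h₁
  choose g hg using h₂
  suffices ∃ x : ℤ → α, x 0 = a ∧ ∀ n, r (x n) (x (n + 1)) by
    obtain ⟨x, hx₀, hx⟩ := this
    refine ⟨fun n => x (n - m), by simpa using hx₀, fun n => ?_⟩
    have := hx (n - m)
    rwa [show n - m + 1 = n + 1 - m by lia] at this
  refine ⟨fun n => match n with
    | Int.ofNat n => f^[n] a
    | Int.negSucc n => g^[n + 1] a, rfl, ?_⟩
  rintro (n | _ | n)
  · change r (f^[n] a) (f^[n + 1] a)
    rw [Function.iterate_succ_apply']
    exact hf _
  · exact hg a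
  · change r (g^[n + 2] a) (g^[n + 1] a)
    rw [Function.iterate_succ_apply' g (n + 1)]
    exact hg _

section
universe w
variable {A : Type*} [Category* A] [Abelian A]

/-- The acyclic complexes of projective objects that remain acyclic under `Hom(-, Q)` for every
projective object `Q`. -/
structure IsCompleteResolution (K : CochainComplex A ℤ) : Prop where
  projective : ∀ n, Projective (K.X n)
  exact : ∀ n, (ShortComplex.mk (K.d n (n + 1)) (K.d (n + 1) (n + 1 + 1))
    (K.d_comp_d _ _ _)).Exact
  exists_extension : ∀ (n : ℤ) (Q : A) [Projective Q] (f : K.X (n + 1) ⟶ Q),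
    K.d n (n + 1) ≫ f = 0 → ∃ g, K.d (n + 1) (n + 1 + 1) ≫ g = f

lemma exact_epi_comp_comp_mono {S : ShortComplex A} (hS : S.Exact) {X Y : A} (q : X ⟶ S.X₁)
    [Epi q] (m : S.X₃ ⟶ Y) [Mono m] : (ShortComplex.mk (q ≫ S.f) (S.g ≫ m) (by simp)).Exact := by
  let φ : ShortComplex.mk (q ≫ S.f) S.g (by simp) ⟶ S := { τ₁ := q, τ₂ := 𝟙 _, τ₃ := 𝟙 _ }
  let ψ : ShortComplex.mk (q ≫ S.f) S.g (by simp) ⟶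
      ShortComplex.mk (q ≫ S.f) (S.g ≫ m) (by simp) :=
    { τ₁ := 𝟙 _, τ₂ := 𝟙 _, τ₃ := m }
  have : Epi φ.τ₁ := ‹_›
  have : Mono ψ.τ₃ := ‹_›
  exact (ShortComplex.exact_iff_of_epi_of_isIso_of_mono ψ).1
    ((ShortComplex.exact_iff_of_epi_of_isIso_of_mono φ).2 hS)

section
variable {K : CochainComplex A ℤ} {x : ℤ → A} {i : ∀ n, x n ⟶ K.X n} {p : ∀ n, K.X n ⟶ x (n + 1)}
  {w : ∀ n, i n ≫ p n = 0} (h : ∀ n, (ShortComplex.mk (i n) (p n) (w n)).ShortExact)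
  (hd : ∀ n, K.d n (n + 1) = p n ≫ i (n + 1))
include h hd

lemma exact_splice (n : ℤ) :
    (ShortComplex.mk (i n) (K.d n (n + 1))
      (by rw [hd, reassoc_of% w n, zero_comp])).Exact := by
  have := (h (n + 1)).mono_f
  have := exact_epi_comp_comp_mono (h n).exact (𝟙 _) (i (n + 1))
  simpa only [hd, Category.id_comp] using this

variable [HasExt.{w} A]

lemma IsCompleteResolution.of_splice [∀ n, Projective (K.X n)] (hx : ∀ n, ExtVanishAbove 0 (x n)) :
    IsCompleteResolution K where
  projective := inferInstance
  exact n := by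
    have := (h n).epi_g
    have := (h (n + 1 + 1)).mono_f
    simpa only [hd] using exact_epi_comp_comp_mono (h (n + 1)).exact (p n) (i (n + 1 + 1))
  exists_extension n Q _ f hf := by
    have := (h n).epi_g
    have := (h (n + 1)).epi_g
    have hf' : i (n + 1) ≫ f = 0 := by
      rwa [← cancel_epi (p n), comp_zero, ← Category.assoc, ← hd]
    obtain ⟨g, rfl⟩ := (h (n + 1)).exact.desc' f hf'
    obtain ⟨g', rfl⟩ := (hx _).exists_extension (h (n + 1 + 1)) g
    exact ⟨g', by rw [hd, Category.assoc]⟩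
end

lemma gorensteinProjective.exists_isCompleteResolution [HasExt.{w} A] [EnoughProjectives A] {X : A}
    (hX : gorensteinProjective X) :
    ∃ K : CochainComplex A ℤ, IsCompleteResolution K ∧ ∃ (i : X ⟶ K.X 1) (w : i ≫ K.d 1 2 = 0),
      Mono i ∧ (ShortComplex.mk i (K.d 1 2) w).Exact := by
  let r (X Y : {X : A // gorensteinProjective X}) : Prop :=
    ∃ (P : A) (i : X.1 ⟶ P) (p : P ⟶ Y.1) (w : i ≫ p = 0),
      (ShortComplex.mk i p w).ShortExact ∧ Projective P
  obtain ⟨x, hx₁, hx⟩ := exists_int_chain r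
    (fun X => by
      obtain ⟨P, i, _, hP, hZ⟩ := X.2.hasCosyzygyIn
      exact ⟨⟨_, hZ⟩, P, i, cokernel.π i, cokernel.condition i,
        { exact := ShortComplex.exact_cokernel i }, hP⟩)
    (fun X => by
      let S := ShortComplex.mk _ _ (kernel.condition (Projective.π X.1))
      have hS : S.ShortExact := { exact := ShortComplex.exact_kernel _ }
      have : Projective S.X₂ := inferInstanceAs (Projective (Projective.over X.1))
      exact ⟨⟨_, .syzygy hS X.2⟩, _, S.f, S.g, S.zero, hS, this⟩) ⟨X, hX⟩ 1
  choose P i p w h hP using hx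
  let K : CochainComplex A ℤ := CochainComplex.of P (fun n => p n ≫ i (n + 1)) fun n => by
    rw [Category.assoc, reassoc_of% w (n + 1), zero_comp, comp_zero]
  have hd (n : ℤ) : K.d n (n + 1) = p n ≫ i (n + 1) :=
    CochainComplex.of_d (X := P) (fun n => p n ≫ i (n + 1)) n
  obtain rfl : (x 1).1 = X := congrArg Subtype.val hx₁
  have : ∀ n, Projective (K.X n) := hP
  exact ⟨K, .of_splice (x := fun n => (x n).1) h hd fun n => (x n).2.extVanishAbove,
    i 1, _, (h 1).mono_f, exact_splice (x := fun n => (x n).1) h hd 1⟩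

end

/-! ### Finitely presented modules -/

section
variable {R : Type u} [Ring R]

lemma FPMod.epi_iff {X Y : FPMod R} (f : X ⟶ Y) : Epi f ↔ Function.Surjective f.hom.hom := by
  refine ⟨fun _ => FPMod.surjective_of_epi f, fun h => ?_⟩
  have : Epi ((isFinitelyPresented R).ι.map f) := (ModuleCat.epi_iff_surjective _).2 h
  exact (isFinitelyPresented R).ι.epi_of_epi_map this

instance : (isGorensteinProjective R).IsClosedUnderIsomorphisms where
  of_iso := by
    rintro X Y e ⟨P, hP, ⟨e'⟩⟩
    exact ⟨P, hP, ⟨((isFinitelyPresented R).ι.mapIso e).toLinearEquiv.symm ≪≫ₗ e'⟩⟩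

lemma IsTotallyAcyclic.isGorensteinProjective {P : CochainComplex (ModuleCat.{u} R) ℤ}
    (hP : IsTotallyAcyclic P) {i j : ℤ} (hij : i + 1 = j) {G : FPMod R}
    (e : G.obj ≃ₗ[R] LinearMap.ker (P.d i j).hom) : isGorensteinProjective R G := by
  obtain ⟨n, rfl⟩ : ∃ n, i = 1 + n := ⟨i - 1, by lia⟩
  obtain rfl : j = 2 + n := by lia
  let P' : CochainComplex (ModuleCat.{u} R) ℤ :=
    { X := fun i => P.X (i + n)
      d := fun i j => P.d (i + n) (j + n)
      shape := fun i j h => P.shape _ _ (fun h' => h (by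
        simp only [ComplexShape.up_Rel] at h' ⊢; lia))
      d_comp_d' := fun _ _ _ _ _ => P.d_comp_d _ _ _ }
  have hP' : IsTotallyAcyclic P' :=
    { finite := fun _ => hP.finite _
      projective := fun _ => hP.projective _
      exact := fun i j k h h' => hP.exact _ _ _ (by lia) (by lia)
      dual_exact := fun i j k h h' => hP.dual_exact _ _ _ (by lia) (by lia) }
  exact ⟨P', hP', ⟨e⟩⟩

variable [IsLeftCoherentRing R]

instance : (isFinitelyPresented R).ι.PreservesHomology where
  preservesKernels _ _ f := (isFinitelyPresented R).preservesKernels_ι f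
  preservesCokernels _ _ f := (isFinitelyPresented R).preservesCokernels_ι f

lemma FPMod.exact_iff (S : ShortComplex (FPMod R)) :
    S.Exact ↔ Function.Exact S.f.hom.hom S.g.hom.hom := by
  rw [← S.exact_map_iff_of_faithful (isFinitelyPresented R).ι,
    ShortComplex.ShortExact.moduleCat_exact_iff_function_exact]
  rfl

lemma FPMod.mono_iff {X Y : FPMod R} (f : X ⟶ Y) : Mono f ↔ Function.Injective f.hom.hom := by
  rw [← (isFinitelyPresented R).ι.mono_map_iff_mono f]
  exact ModuleCat.mono_iff_injective _

lemma FPMod.nonempty_linearEquiv_ker {S : ShortComplex (FPMod R)} (hS : S.Exact) [Mono S.f] :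
    Nonempty (S.X₁.obj ≃ₗ[R] LinearMap.ker S.g.hom.hom) := by
  have hker : LinearMap.ker S.g.hom.hom = LinearMap.range S.f.hom.hom :=
    ((FPMod.exact_iff S).1 hS).linearMap_ker_eq
  rw [hker]
  exact ⟨LinearEquiv.ofInjective _ ((FPMod.mono_iff S.f).1 ‹_›)⟩

instance : EnoughProjectives (FPMod R) where
  presentation M := by
    have : Module.FinitePresentation R M.obj := M.property
    obtain ⟨n, m, f, -, hf, -⟩ := Module.FinitePresentation.exists_fin' R M.obj
    let F : FPMod R := ⟨ModuleCat.of R (Fin n → R),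
      (inferInstance : Module.FinitePresentation R (Fin n → R))⟩
    exact ⟨{
      p := F
      projective := (isProj_iff F).1 (inferInstance : Module.Projective R (Fin n → R))
      f := ObjectProperty.homMk (ModuleCat.ofHom f)
      epi := (FPMod.epi_iff _).2 hf }⟩

instance : HasExt.{u + 1} (FPMod R) := hasExt_of_hasDerivedCategory _

lemma Cosyzygy.shortExact {X : Gproj R} (c : Cosyzygy X) :
    (ShortComplex.mk c.ι c.π c.ι_π).ShortExact where
  exact := (FPMod.exact_iff _).2 c.exact
  mono_f := (FPMod.mono_iff _).2 c.injective
  epi_g := (FPMod.epi_iff _).2 c.surjective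

instance {X : Gproj R} (c : Cosyzygy X) : Projective c.I := (isProj_iff _).1 c.projective

lemma isGorensteinProjective.exists_shortExact {G : FPMod R} (hG : isGorensteinProjective R G) :
    ∃ T : ShortComplex (FPMod R), T.ShortExact ∧ T.X₃ = G ∧ Projective T.X₂ ∧
      isGorensteinProjective R T.X₁ := by
  obtain ⟨P, hP, ⟨e⟩⟩ := hG
  have := hP.projective
  have := hP.finite
  let F : FPMod R := ⟨P.X 0, Module.finitePresentation_of_projective _ _⟩
  let d : P.X 0 →ₗ[R] LinearMap.ker (P.d 1 2).hom := (P.d 0 1).hom.codRestrict _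
    (hP.exact 0 1 2 rfl rfl).apply_apply_eq_zero
  have hd : Function.Surjective d := by
    rintro ⟨y, hy⟩
    obtain ⟨x, rfl⟩ := (hP.exact 0 1 2 rfl rfl y).1 hy
    exact ⟨x, rfl⟩
  let p : F ⟶ G := ObjectProperty.homMk (ModuleCat.ofHom (e.symm.toLinearMap ∘ₗ d))
  have : Epi p := (FPMod.epi_iff p).2 (e.symm.surjective.comp hd)
  obtain ⟨e'⟩ := FPMod.nonempty_linearEquiv_ker (ShortComplex.exact_kernel p)
  have hker : LinearMap.ker p.hom.hom = LinearMap.ker (P.d 0 1).hom :=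
    (LinearEquiv.ker_comp e.symm d).trans (LinearMap.ker_codRestrict _ _ _)
  exact ⟨ShortComplex.mk (kernel.ι p) p (kernel.condition p),
    { exact := ShortComplex.exact_kernel p }, rfl, (isProj_iff F).1 (hP.projective 0),
    hP.isGorensteinProjective (zero_add 1) (e' ≪≫ₗ LinearEquiv.ofEq _ _ hker)⟩

lemma isCosyzygyClosed_isGorensteinProjective :
    IsCosyzygyClosed (isGorensteinProjective R) where
  ext := by
    refine le_extVanishAbove_zero fun G hG => ?_
    obtain ⟨T, hT, rfl, hP, hK⟩ := hG.exists_shortExact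
    refine ⟨T, hT, rfl, hP, hK, fun Q hQ f => ?_⟩
    have : Module.Projective R Q.obj := (isProj_iff Q).2 hQ
    have : Module.FinitePresentation R Q.obj := Q.property
    obtain ⟨g, hg⟩ := hG.exists_extension T.f.hom.hom T.g.hom.hom
      ((FPMod.mono_iff _).1 hT.mono_f) ((FPMod.epi_iff _).1 hT.epi_g)
      ((FPMod.exact_iff _).1 hT.exact) f.hom.hom
    exact ⟨ObjectProperty.homMk (ModuleCat.ofHom g), by ext y; exact LinearMap.congr_fun hg y⟩
  cosyzygy G hG := by
    obtain ⟨c⟩ := nonempty_cosyzygy ⟨G, hG⟩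
    exact HasCosyzygyIn.of_shortExact c.shortExact c.S.property

lemma IsCompleteResolution.isTotallyAcyclic {K : CochainComplex (FPMod R) ℤ}
    (hK : IsCompleteResolution K) : IsTotallyAcyclic
      (((isFinitelyPresented R).ι.mapHomologicalComplex (ComplexShape.up ℤ)).obj K) where
  finite n := by
    have : Module.FinitePresentation R (K.X n).obj := (K.X n).property
    exact inferInstanceAs (Module.Finite R (K.X n).obj)
  projective n := (isProj_iff _).2 (hK.projective n)
  exact := by
    rintro n _ _ rfl rfl
    exact (FPMod.exact_iff _).1 (hK.exact n)
  dual_exact := by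
    rintro n _ _ rfl rfl φ
    let RR : FPMod R := ⟨ModuleCat.of R R, (inferInstance : Module.FinitePresentation R R)⟩
    have : Projective RR := (isProj_iff RR).1 (inferInstance : Module.Projective R R)
    constructor
    · intro hφ
      obtain ⟨g, hg⟩ := hK.exists_extension n RR (ObjectProperty.homMk (ModuleCat.ofHom φ))
        (by ext y; exact LinearMap.congr_fun hφ y)
      exact ⟨g.hom.hom, congrArg (fun g => g.hom.hom) hg⟩
    · rintro ⟨χ, rfl⟩
      have := congrArg (fun g => g.hom.hom) (K.d_comp_d n (n + 1) (n + 1 + 1))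
      ext y
      exact (congrArg χ (LinearMap.congr_fun this y)).trans (map_zero χ)

lemma isGorensteinProjective_eq : isGorensteinProjective R = gorensteinProjective := by
  refine le_antisymm isCosyzygyClosed_isGorensteinProjective.le fun X hX => ?_
  obtain ⟨K, hK, i, w, _, hi⟩ := hX.exists_isCompleteResolution
  exact ⟨_, hK.isTotallyAcyclic, FPMod.nonempty_linearEquiv_ker hi⟩

instance : (isGorensteinProjective R).IsClosedUnderExtensions := by
  rw [isGorensteinProjective_eq]; infer_instance

instance : (isGorensteinProjective R).IsStableUnderRetracts := by
  rw [isGorensteinProjective_eq]; infer_instance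

lemma isGorensteinProjective.extVanishAbove {G : FPMod R} (hG : isGorensteinProjective R G) :
    ExtVanishAbove 0 G := isCosyzygyClosed_isGorensteinProjective.ext G hG

lemma isGorensteinProjective.of_projective {P : FPMod R} [Projective P] :
    isGorensteinProjective R P := by
  rw [isGorensteinProjective_eq]
  exact .of_projective

end

/-! ### Perfect complexes and brutal truncations -/

section
universe w w'
open DerivedCategory Pretriangulated
variable {A : Type*} [Category* A] [Abelian A]

section
variable (K : CochainComplex A ℤ) (a : ℤ) [K.IsStrictlyGE a]

/-- The projection of a complex in degrees `≥ a` to its component in degree `a`. Its kernel is the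
brutal truncation in degrees `> a`. -/
noncomputable def toLowestTerm :
    K ⟶ (HomologicalComplex.single A (ComplexShape.up ℤ) a).obj (K.X a) :=
  HomologicalComplex.mkHomToSingle (𝟙 _) fun i hi => by
    have : i + 1 = a := hi
    exact (K.isZero_of_isStrictlyGE a i (by lia)).eq_of_src _ _

instance : IsIso ((toLowestTerm K a).f a) := by
  rw [toLowestTerm, HomologicalComplex.mkHomToSingle_f]
  infer_instance

instance (i : ℤ) : Epi ((toLowestTerm K a).f i) := by
  by_cases hi : i = a
  · subst hi
    infer_instance
  · exact ⟨fun _ _ _ => (HomologicalComplex.isZero_single_obj_X _ _ _ i hi).eq_of_src _ _⟩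

instance : Epi (toLowestTerm K a) := HomologicalComplex.epi_of_epi_f _ inferInstance

lemma shortExact_toLowestTerm : (ShortComplex.mk _ (toLowestTerm K a)
    (kernel.condition (toLowestTerm K a))).ShortExact where
  exact := ShortComplex.exact_kernel _

instance : (kernel (toLowestTerm K a)).IsStrictlyGE (a + 1) := by
  rw [CochainComplex.isStrictlyGE_iff]
  intro i hi
  obtain rfl | hia := eq_or_ne i a
  · refine IsZero.of_mono_eq_zero ((kernel.ι (toLowestTerm K i)).f i) ?_
    rw [← cancel_mono ((toLowestTerm K i).f i), zero_comp, ← HomologicalComplex.comp_f,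
      kernel.condition, HomologicalComplex.zero_f]
  · exact (K.isZero_of_isStrictlyGE a i (by lia)).of_mono ((kernel.ι (toLowestTerm K a)).f i)

instance (b : ℤ) [K.IsStrictlyLE b] : (kernel (toLowestTerm K a)).IsStrictlyLE b := by
  rw [CochainComplex.isStrictlyLE_iff]
  exact fun i hi =>
    (K.isZero_of_isStrictlyLE b i hi).of_mono ((kernel.ι (toLowestTerm K a)).f i)

lemma projective_single_X (i : ℤ) (P : A) [Projective P] : Projective
    (((HomologicalComplex.single A (ComplexShape.up ℤ) a).obj P).X i) := by
  obtain rfl | hi := eq_or_ne i a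
  · exact .of_iso (HomologicalComplex.singleObjXSelf (ComplexShape.up ℤ) i P).symm ‹_›
  · exact (HomologicalComplex.isZero_single_obj_X _ _ _ i hi).projective

instance [∀ i, Projective (K.X i)] (i : ℤ) : Projective ((kernel (toLowestTerm K a)).X i) := by
  let S := (ShortComplex.mk _ (toLowestTerm K a) (kernel.condition (toLowestTerm K a))).map
    (HomologicalComplex.eval A (ComplexShape.up ℤ) i)
  have hS : S.ShortExact := (shortExact_toLowestTerm K a).map_of_exact _
  have : Projective S.X₃ := projective_single_X a i (K.X a)
  let σ := hS.splittingOfProjective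
  exact Retract.projective (Y := K.X i) ⟨S.f, σ.r, σ.f_r⟩

end

variable [HasDerivedCategory.{w} A]

lemma exists_Q_map_eq_of_projective (K L : CochainComplex A ℤ) (b : ℤ) [K.IsStrictlyLE b]
    [∀ i, Projective (K.X i)] (f : Q.obj K ⟶ Q.obj L) : ∃ g : K ⟶ L, Q.map g = f := by
  have := CochainComplex.isKProjective_of_projective K b
  obtain ⟨g, hg⟩ := (CochainComplex.IsKProjective.Qh_map_bijective K
    ((HomotopyCategory.quotient _ _).obj L)).surjective
    ((quotientCompQhIso _).hom.app K ≫ f ≫ (quotientCompQhIso _).inv.app L)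
  obtain ⟨g, rfl⟩ := (HomotopyCategory.quotient _ _).map_surjective g
  refine ⟨g, ?_⟩
  rw [← cancel_epi ((quotientCompQhIso _).hom.app K), ← quotientCompQhIso_hom_naturality g, hg]
  simp only [Category.assoc, Iso.inv_hom_id_app, Category.comp_id]

lemma exists_Q_map_eq_single (K : CochainComplex A ℤ) (b : ℤ) [K.IsStrictlyLE b]
    [∀ i, Projective (K.X i)] (m : ℤ) (Y : A) (f : Q.obj K ⟶ (singleFunctor A m).obj Y) :
    ∃ g : K ⟶ (HomologicalComplex.single A (ComplexShape.up ℤ) m).obj Y, Q.map g = f :=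
  exists_Q_map_eq_of_projective K _ b f

/-- The stalk complex in degree `-n` as the `n`-th shift of the stalk complex in degree zero. -/
noncomputable def singleShiftIso (n : ℤ) (Y : A) :
    ((singleFunctor A 0).obj Y)⟦n⟧ ≅ (singleFunctor A (-n)).obj Y :=
  ((singleFunctors A).shiftIso n (-n) 0 (by lia)).app Y

lemma hom_shift_eq_zero (K : CochainComplex A ℤ) (b : ℤ) [K.IsStrictlyLE b]
    [∀ i, Projective (K.X i)] (n : ℤ) (hn : IsZero (K.X (-n))) (Y : A)
    (f : Q.obj K ⟶ ((singleFunctor A 0).obj Y)⟦n⟧) : f = 0 := by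
  rw [← cancel_mono (singleShiftIso n Y).hom, zero_comp]
  obtain ⟨g, hg⟩ := exists_Q_map_eq_single K b (-n) Y (f ≫ (singleShiftIso n Y).hom)
  obtain rfl : g = 0 := HomologicalComplex.to_single_hom_ext (hn.eq_of_src _ _)
  rw [← hg]
  exact Functor.map_zero _ _ _

lemma exists_factors_single (K : CochainComplex A ℤ) (b : ℤ) [K.IsStrictlyGE 0]
    [K.IsStrictlyLE b] [∀ i, Projective (K.X i)] {Y : A}
    (f : Q.obj K ⟶ (singleFunctor A 0).obj Y) :
    ∃ (g : Q.obj K ⟶ (singleFunctor A 0).obj (K.X 0)) (h : K.X 0 ⟶ Y),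
      g ≫ (singleFunctor A 0).map h = f := by
  obtain ⟨f, rfl⟩ := exists_Q_map_eq_single K b 0 Y f
  let h : K.X 0 ⟶ Y :=
    f.f 0 ≫ (HomologicalComplex.singleObjXSelf (ComplexShape.up ℤ) 0 Y).hom
  have hf : toLowestTerm K 0 ≫ (HomologicalComplex.single A (ComplexShape.up ℤ) 0).map h = f := by
    apply HomologicalComplex.to_single_hom_ext
    rw [HomologicalComplex.comp_f, toLowestTerm, HomologicalComplex.mkHomToSingle_f,
      HomologicalComplex.single_map_f_self]
    simp [h]
  exact ⟨Q.map (toLowestTerm K 0), h, (Q.map_comp _ _).symm.trans (congrArg Q.map hf)⟩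

variable [HasExt.{w'} A]

lemma extVanishAbove_iff {m : ℕ} {X : A} : ExtVanishAbove m X ↔
    ∀ (P : A) [Projective P] (n : ℕ), m < n →
      ∀ f : (singleFunctor A 0).obj X ⟶ ((singleFunctor A 0).obj P)⟦(n : ℤ)⟧, f = 0 := by
  refine forall₄_congr fun P _ n _ => ?_
  rw [Abelian.Ext.homEquiv.subsingleton_congr, subsingleton_iff_forall_eq 0]

lemma ExtVanishAbove.hom_single_eq_zero {m n : ℕ} {X : A} (hX : ExtVanishAbove m X) (hn : m < n)
    (P : A) [Projective P] (f : (singleFunctor A 0).obj X ⟶ (singleFunctor A (-n)).obj P) :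
    f = 0 := by
  rw [← cancel_mono (singleShiftIso n P).inv, zero_comp]
  exact extVanishAbove_iff.1 hX P n hn _

/-- The obstruction to lifting `g` to the brutal truncation of `K` in degrees `> -n` lies in
`Extⁿ(X, K.X (-n))`. -/
lemma ExtVanishAbove.exists_factors {X : A} (hX : ExtVanishAbove 0 X) (d : ℕ)
    (K : CochainComplex A ℤ) (b : ℤ) [K.IsStrictlyGE (-d)] [K.IsStrictlyLE b]
    [∀ i, Projective (K.X i)] (g : (singleFunctor A 0).obj X ⟶ Q.obj K) :
    ∃ (K' : CochainComplex A ℤ) (f : (singleFunctor A 0).obj X ⟶ Q.obj K')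
      (i : Q.obj K' ⟶ Q.obj K),
      K'.IsStrictlyGE 0 ∧ K'.IsStrictlyLE b ∧ (∀ i, Projective (K'.X i)) ∧ f ≫ i = g := by
  induction d generalizing K with
  | zero => exact ⟨K, g, 𝟙 _, ‹_›, ‹_›, inferInstance, Category.comp_id g⟩
  | succ d ih =>
    let a : ℤ := -(d + 1 : ℕ)
    have : (kernel (toLowestTerm K a)).IsStrictlyGE (-d) :=
      CochainComplex.isStrictlyGE_of_ge _ _ (a + 1) (by lia)
    obtain ⟨g, rfl⟩ := Triangle.coyoneda_exact₂ _
      (triangleOfSES_distinguished (shortExact_toLowestTerm K a)) g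
      (hX.hom_single_eq_zero (n := d + 1) d.succ_pos (K.X a) _)
    obtain ⟨K', f, i, h₁, h₂, h₃, rfl⟩ := ih (kernel (toLowestTerm K a)) g
    exact ⟨K', f, _, h₁, h₂, h₃, (Category.assoc _ _ _).symm⟩

end

/-! ### The singularity category -/

section
open Pretriangulated ZeroObject
variable {C D : Type*} [Category* C] [Preadditive C] [HasZeroObject C]
  [HasShift C ℤ] [∀ n : ℤ, (shiftFunctor C n).Additive] [Pretriangulated C]
  (N : ObjectProperty C) [Category* D] (L : C ⥤ D) [L.IsLocalization N.trW]

lemma isZero_map_obj_of_prop [Preadditive D] [L.Additive] {P : C} (hP : N P) :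
    IsZero (L.obj P) := by
  have : IsIso (L.map (0 : 0 ⟶ P)) := Localization.inverts L N.trW _
    (ObjectProperty.trW.mk _ (contractible_distinguished₁ P) hP)
  exact (L.map_isZero (isZero_zero C)).of_iso (asIso (L.map (0 : 0 ⟶ P))).symm

variable [N.IsTriangulated] [IsTriangulated C] {X Y : C}

/-- `P` and `P'` are the cones of the denominators of fractions representing `r.i` and `r.r`. -/
lemma exists_hom_eq_zero_of_retract (r : Retract (L.obj X) (L.obj Y)) :
    ∃ P P' : C, N P ∧ N P' ∧ ∀ W : C, (∀ f : P ⟶ W, f = 0) → (∀ f : P' ⟶ W, f = 0) →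
      (∀ f : Y ⟶ W, f = 0) → ∀ f : X ⟶ W, f = 0 := by
  obtain ⟨φ, hφ⟩ := Localization.exists_rightFraction L N.trW r.i
  obtain ⟨ψ, hψ⟩ := Localization.exists_leftFraction L N.trW r.r
  have hφψ : L.map (φ.f ≫ ψ.f) = L.map (φ.s ≫ ψ.s) := by
    rw [L.map_comp, L.map_comp, ← φ.map_s_comp_map L (Localization.inverts L N.trW),
      ← ψ.map_comp_map_s L (Localization.inverts L N.trW), ← hφ, ← hψ, Category.assoc,
      r.retract_assoc]
  obtain ⟨V, t, ht, h⟩ := (MorphismProperty.map_eq_iff_postcomp L N.trW _ _).1 hφψ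
  rw [Category.assoc, Category.assoc] at h
  obtain ⟨P, _, _, hT, hP⟩ := (N.trW_iff' _).1 (N.trW.comp_mem _ _ ψ.hs ht)
  obtain ⟨P', a, _, hT', hP'⟩ := (N.trW_iff φ.s).1 φ.hs
  refine ⟨P, P', hP, hP', fun W hPW hP'W hYW f => ?_⟩
  obtain ⟨k, rfl⟩ : ∃ k, f = (ψ.s ≫ t) ≫ k := Triangle.yoneda_exact₂ _ hT f (hPW _)
  have hk : φ.s ≫ (ψ.s ≫ t) ≫ k = 0 := by
    rw [← Category.assoc, ← h, Category.assoc, hYW ((ψ.f ≫ t) ≫ k), comp_zero]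
  obtain ⟨l, hl⟩ : ∃ l, (ψ.s ≫ t) ≫ k = a ≫ l := Triangle.yoneda_exact₂ _ hT' _ hk
  rw [hl, hP'W l, comp_zero]

variable [Preadditive D] [L.Additive]

lemma exists_map_eq_of_factors
    (H : ∀ P, N P → ∀ g : X ⟶ P, ∃ (P' : C) (a : X ⟶ P') (b : P' ⟶ P), N P' ∧ a ≫ b = g ∧
      ∀ k : P' ⟶ Y⟦(1 : ℤ)⟧, k = 0) (φ : L.obj X ⟶ L.obj Y) : ∃ f : X ⟶ Y, L.map f = φ := by
  obtain ⟨⟨f, s, hs⟩, rfl⟩ := Localization.exists_leftFraction L N.trW φ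
  obtain ⟨P, t, h, hT, hP⟩ := (N.trW_iff s).1 hs
  obtain ⟨P', a, b, hP', hab, hk⟩ := H P hP (f ≫ t)
  -- The part `a ≫ b` of `f` that does not lift along `s` factors through `N`, so `L` kills it.
  obtain ⟨b, rfl⟩ : ∃ b', b = b' ≫ t := Triangle.coyoneda_exact₃ _ hT b (hk _)
  have hft : (f - a ≫ b) ≫ t = 0 := by
    rw [Preadditive.sub_comp, Category.assoc, hab, sub_self]
  obtain ⟨c, hc⟩ : ∃ c, f - a ≫ b = c ≫ s := Triangle.coyoneda_exact₂ _ hT _ hft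
  have hab : L.map (a ≫ b) = 0 := by
    rw [L.map_comp, (isZero_map_obj_of_prop N L hP').eq_of_tgt (L.map a) 0, zero_comp]
  have := Localization.inverts L N.trW s hs
  refine ⟨c, ?_⟩
  rw [← cancel_mono (L.map s), MorphismProperty.LeftFraction.map_comp_map_s, ← L.map_comp, ← hc,
    L.map_sub, hab, sub_zero]

lemma exists_factors_of_map_eq_zero (f : X ⟶ Y) (hf : L.map f = 0) :
    ∃ (P : C) (a : X ⟶ P) (b : P ⟶ Y), N P ∧ a ≫ b = f := by
  obtain ⟨Z, s, hs, h⟩ :=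
    (MorphismProperty.map_eq_iff_postcomp L N.trW f 0).1 (hf.trans (L.map_zero X Y).symm)
  obtain ⟨P, i, t, hT, hP⟩ := (N.trW_iff' s).1 hs
  obtain ⟨l, rfl⟩ : ∃ l, f = l ≫ i := Triangle.coyoneda_exact₂ _ hT f (h.trans zero_comp)
  exact ⟨P, l, i, hP, rfl⟩

end

section
variable (R : Type u) [Ring R] [IsLeftCoherentRing R]
open DerivedCategory Pretriangulated

/-- The functor sending a finitely presented module to its stalk complex in `D_sg(R)`. -/
noncomputable abbrev moduleToDsg : FPMod R ⥤ Dsg R := stalk R ⋙ toDsg R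

/-- The objects of the bounded derived category isomorphic to a bounded complex of finitely
generated projective modules concentrated in nonnegative degrees. -/
def isPerfectNonneg : ObjectProperty (Bounded (FPMod R)) := fun P =>
  ∃ (K : CochainComplex (FPMod R) ℤ) (b : ℤ), K.IsStrictlyGE 0 ∧ K.IsStrictlyLE b ∧
    (∀ i, Projective (K.X i)) ∧ Nonempty (Bounded.ι.obj P ≅ Q.obj K)

instance : (stalk R).Full where
  map_surjective f :=
    have ⟨g, hg⟩ := (singleFunctor (FPMod R) 0).map_surjective (Bounded.ι.map f)
    ⟨g, Bounded.ι.map_injective hg⟩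

instance : (stalk R).Faithful where
  map_injective h := (singleFunctor (FPMod R) 0).map_injective (congrArg Bounded.ι.map h)

variable {R}

lemma isPerfectBounded_iff (P : Bounded (FPMod R)) : isPerfectBounded R P ↔
    ∃ (K : CochainComplex (FPMod R) ℤ) (a b : ℤ), K.IsStrictlyGE a ∧ K.IsStrictlyLE b ∧
      (∀ i, Projective (K.X i)) ∧ Nonempty (Bounded.ι.obj P ≅ Q.obj K) := by
  constructor
  · rintro ⟨K, ⟨a, ha⟩, ⟨b, hb⟩, hK, e⟩
    exact ⟨K, a, b, ha, hb, fun i => (isProj_iff _).1 (hK i), e⟩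
  · rintro ⟨K, a, b, ha, hb, hK, e⟩
    exact ⟨K, ⟨a, ha⟩, ⟨b, hb⟩, fun i => (isProj_iff _).2 (hK i), e⟩

/-- A bounded complex as an object of the bounded derived category. -/
noncomputable def toBounded (K : CochainComplex (FPMod R) ℤ) (a b : ℤ) [K.IsStrictlyGE a]
    [K.IsStrictlyLE b] : Bounded (FPMod R) :=
  ⟨Q.obj K, ⟨a, inferInstanceAs ((Q.obj K).IsGE a)⟩, ⟨b, inferInstanceAs ((Q.obj K).IsLE b)⟩⟩

lemma bounded_hom_shift_eq_zero {P : Bounded (FPMod R)} {Y : FPMod R} (n : ℤ)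
    (h : ∀ f : Bounded.ι.obj P ⟶ ((singleFunctor (FPMod R) 0).obj Y)⟦n⟧, f = 0)
    (f : P ⟶ ((stalk R).obj Y)⟦n⟧) : f = 0 := by
  apply Bounded.ι.map_injective
  rw [← cancel_mono ((Bounded.ι.commShiftIso n).hom.app _), Functor.map_zero, zero_comp]
  exact h _

lemma exists_forall_hom_shift_eq_zero {P : Bounded (FPMod R)} (hP : isPerfectBounded R P) :
    ∃ m : ℤ, ∀ (Y : FPMod R) (n : ℤ), m < n → ∀ f : P ⟶ ((stalk R).obj Y)⟦n⟧, f = 0 := by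
  obtain ⟨K, a, b, _, _, _, ⟨e⟩⟩ := (isPerfectBounded_iff P).1 hP
  refine ⟨-a, fun Y n hn => bounded_hom_shift_eq_zero n fun f => ?_⟩
  rw [← cancel_epi e.inv, comp_zero]
  exact hom_shift_eq_zero K b n (K.isZero_of_isStrictlyGE a _ (by lia)) Y _

namespace isPerfectNonneg
variable {P : Bounded (FPMod R)} (hP : isPerfectNonneg R P) {Y : FPMod R}
include hP

lemma isPerfectBounded : isPerfectBounded R P := by
  obtain ⟨K, b, h₁, h₂, hK, e⟩ := hP
  exact (isPerfectBounded_iff P).2 ⟨K, 0, b, h₁, h₂, hK, e⟩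

lemma hom_shift_one_eq_zero (f : P ⟶ ((stalk R).obj Y)⟦(1 : ℤ)⟧) : f = 0 := by
  obtain ⟨K, b, _, _, _, ⟨e⟩⟩ := hP
  refine bounded_hom_shift_eq_zero 1 (fun f => ?_) f
  rw [← cancel_epi e.inv, comp_zero]
  exact hom_shift_eq_zero K b 1 (K.isZero_of_isStrictlyGE 0 _ (by lia)) Y _

lemma exists_factors_stalk (f : P ⟶ (stalk R).obj Y) :
    ∃ (Q : FPMod R) (_ : Projective Q) (g : P ⟶ (stalk R).obj Q) (h : Q ⟶ Y),
      g ≫ (stalk R).map h = f := by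
  obtain ⟨K, b, _, _, hK, ⟨e⟩⟩ := hP
  obtain ⟨g, h, hgh⟩ := exists_factors_single K b (Y := Y) (e.inv ≫ Bounded.ι.map f)
  exact ⟨K.X 0, hK 0, ObjectProperty.homMk (e.hom ≫ g), h, Bounded.ι.map_injective
    ((Category.assoc _ _ _).trans ((e.eq_inv_comp).1 hgh))⟩

end isPerfectNonneg

lemma ExtVanishAbove.exists_factors_perfect {X : FPMod R} (hX : ExtVanishAbove 0 X)
    {P : Bounded (FPMod R)} (hP : isPerfectBounded R P) (g : (stalk R).obj X ⟶ P) :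
    ∃ (P' : Bounded (FPMod R)) (_ : isPerfectNonneg R P') (f : (stalk R).obj X ⟶ P')
      (h : P' ⟶ P), f ≫ h = g := by
  obtain ⟨K, a, b, _, _, _, ⟨e⟩⟩ := (isPerfectBounded_iff P).1 hP
  have : K.IsStrictlyGE (-(-a).toNat) := CochainComplex.isStrictlyGE_of_ge _ _ a (by lia)
  obtain ⟨K', f, i, h₁, h₂, h₃, hfi⟩ :=
    hX.exists_factors (-a).toNat K b (Bounded.ι.map g ≫ e.hom)
  exact ⟨toBounded K' 0 b, ⟨K', b, h₁, h₂, h₃, ⟨Iso.refl _⟩⟩, ObjectProperty.homMk f,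
    ObjectProperty.homMk (i ≫ e.inv), Bounded.ι.map_injective
      ((Category.assoc _ _ _).symm.trans ((e.comp_inv_eq).2 hfi))⟩

lemma ExtVanishAbove.exists_map_eq {X Y : FPMod R} (hX : ExtVanishAbove 0 X)
    (φ : (moduleToDsg R).obj X ⟶ (moduleToDsg R).obj Y) :
    ∃ f : X ⟶ Y, (moduleToDsg R).map f = φ := by
  obtain ⟨f, rfl⟩ := exists_map_eq_of_factors (isPerfectBounded R) (toDsg R) (fun P hP g => by
    obtain ⟨P', hP', f, h, hfh⟩ := hX.exists_factors_perfect hP g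
    exact ⟨P', f, h, hP'.isPerfectBounded, hfh, hP'.hom_shift_one_eq_zero⟩) φ
  obtain ⟨f, rfl⟩ := (stalk R).map_surjective f
  exact ⟨f, rfl⟩

lemma ExtVanishAbove.factorsThroughProj {X Y : FPMod R} (hX : ExtVanishAbove 0 X) (f : X ⟶ Y)
    (hf : (moduleToDsg R).map f = 0) : FactorsThroughProj R f := by
  obtain ⟨P, a, b, hP, hab⟩ := exists_factors_of_map_eq_zero (isPerfectBounded R) (toDsg R)
    ((stalk R).map f) hf
  obtain ⟨P', hP', a, h, rfl⟩ := hX.exists_factors_perfect hP a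
  obtain ⟨Q, hQ, g, k, hgk⟩ := hP'.exists_factors_stalk (h ≫ b)
  obtain ⟨l, hl⟩ := (stalk R).map_surjective (a ≫ g)
  refine ⟨Q, (isProj_iff _).2 hQ, l, k, (stalk R).map_injective ?_⟩
  rw [Functor.map_comp, hl, Category.assoc, hgk, ← Category.assoc, hab]

lemma ExtVanishAbove.stalk_hom_eq_zero {X Q : FPMod R} {m n : ℕ} (hX : ExtVanishAbove m X)
    [Projective Q] (hn : m < n) (f : (stalk R).obj X ⟶ ((stalk R).obj Q)⟦(n : ℤ)⟧) : f = 0 :=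
  bounded_hom_shift_eq_zero (P := (stalk R).obj X) n (extVanishAbove_iff.1 hX Q n hn) f

lemma extVanishAbove_of_stalk_hom_eq_zero {X : FPMod R} {m : ℕ}
    (h : ∀ (Q : FPMod R) [Projective Q] (n : ℕ), m < n →
      ∀ f : (stalk R).obj X ⟶ ((stalk R).obj Q)⟦(n : ℤ)⟧, f = 0) : ExtVanishAbove m X := by
  refine extVanishAbove_iff.2 fun Q _ n hn f => ?_
  let σ := (Bounded.ι.commShiftIso (n : ℤ)).app ((stalk R).obj Q)
  refine (cancel_mono σ.inv).1 (Eq.trans ?_ zero_comp.symm)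
  exact congrArg Bounded.ι.map (h Q n hn (ObjectProperty.homMk (f ≫ σ.inv)))

end

/-! ### The triangle functor -/

section
open Pretriangulated DerivedCategory
variable {A : Type*} [Category* A] [Abelian A]

lemma shortExact_of_isPushout {S : ShortComplex A} (hS : S.ShortExact) {Y Z : A} {u : S.X₁ ⟶ Y}
    {v : Y ⟶ Z} {j : S.X₂ ⟶ Z} {w : Z ⟶ S.X₃} (h : IsPushout u S.f v j) (hvw : v ≫ w = 0)
    (hjw : j ≫ w = S.g) : (ShortComplex.mk v w hvw).ShortExact := by
  have := hS.mono_f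
  have := hS.epi_g
  have : Epi w := epi_of_epi_fac hjw
  have : Mono v := (MorphismProperty.monomorphisms A).of_isPushout h ‹Mono S.f›
  have hdesc {W : A} (k : Z ⟶ W) (hk : v ≫ k = 0) : ∃ l, w ≫ l = k := by
    have hjk : S.f ≫ j ≫ k = 0 := by rw [← h.w_assoc, hk, comp_zero]
    refine ⟨hS.exact.desc (j ≫ k) hjk, h.hom_ext ?_ ?_⟩
    · rw [reassoc_of% hvw, zero_comp, hk]
    · rw [reassoc_of% hjw, hS.exact.g_desc]
  have hw : IsColimit (CokernelCofork.ofπ w hvw) :=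
    CokernelCofork.IsColimit.ofπ' _ _ fun k hk => ⟨(hdesc k hk).choose, (hdesc k hk).choose_spec⟩
  exact { exact := ShortComplex.exact_of_g_is_cokernel (ShortComplex.mk v w hvw) hw }

variable {C D : Type*} [Category* C] [Preadditive C] [HasZeroObject C] [HasShift C ℤ]
  [∀ n : ℤ, (shiftFunctor C n).Additive] [Pretriangulated C] [Category* D] [Preadditive D]
  [HasZeroObject D] [HasShift D ℤ] [∀ n : ℤ, (shiftFunctor D n).Additive] [Pretriangulated D]

/-- A `δ`-functor structure on a functor from an abelian to a triangulated category: natural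
connecting morphisms which turn short exact sequences into distinguished triangles. -/
structure DeltaStructure (F : A ⥤ C) where
  δ {S : ShortComplex A} (hS : S.ShortExact) : F.obj S.X₃ ⟶ (F.obj S.X₁)⟦(1 : ℤ)⟧
  distinguished {S : ShortComplex A} (hS : S.ShortExact) :
    Triangle.mk (F.map S.f) (F.map S.g) (δ hS) ∈ distTriang C
  naturality {S₁ S₂ : ShortComplex A} (h₁ : S₁.ShortExact) (h₂ : S₂.ShortExact) (φ : S₁ ⟶ S₂) :
    F.map φ.τ₃ ≫ δ h₂ = δ h₁ ≫ (F.map φ.τ₁)⟦(1 : ℤ)⟧'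

namespace DeltaStructure

/-- The `δ`-functor structure on the stalk complexes of the derived category. -/
noncomputable def single [HasDerivedCategory A] : DeltaStructure (singleFunctor A 0) where
  δ hS := hS.singleδ
  distinguished hS := hS.singleTriangle_distinguished
  naturality h₁ h₂ φ := (ShortComplex.ShortExact.singleTriangle.map h₁ h₂ φ).comm₃.symm

variable {F : A ⥤ C} (d : DeltaStructure F) (G : C ⥤ D) [G.CommShift ℤ]

/-- Transport of a `δ`-functor structure along a triangulated functor. -/
noncomputable def comp [G.IsTriangulated] : DeltaStructure (F ⋙ G) where
  δ {S} hS := G.map (d.δ hS) ≫ (G.commShiftIso (1 : ℤ)).hom.app (F.obj S.X₁)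
  distinguished hS := G.map_distinguished _ (d.distinguished hS)
  naturality h₁ h₂ φ := by
    rw [Functor.comp_map, ← G.map_comp_assoc, d.naturality h₁ h₂, G.map_comp_assoc,
      G.commShiftIso_hom_naturality, Category.assoc, Functor.comp_map]

/-- Reflection of a `δ`-functor structure along a fully faithful triangulated functor. -/
noncomputable def ofComp [G.IsTriangulated] [G.Full] [G.Faithful] (d : DeltaStructure (F ⋙ G)) :
    DeltaStructure F :=
  have hδ {S : ShortComplex A} (hS : S.ShortExact) :
      G.map (G.preimage (d.δ hS ≫ (G.commShiftIso (1 : ℤ)).inv.app (F.obj S.X₁))) ≫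
        (G.commShiftIso (1 : ℤ)).hom.app (F.obj S.X₁) = d.δ hS := by
    rw [G.map_preimage, Category.assoc, Iso.inv_hom_id_app]
    exact Category.comp_id _
  { δ {S} hS := G.preimage (d.δ hS ≫ (G.commShiftIso (1 : ℤ)).inv.app (F.obj S.X₁))
    distinguished {S} hS := by
      rw [← G.map_distinguished_iff]
      exact (congrArg (Triangle.mk _ _ · ∈ distTriang D) (hδ hS)).mpr (d.distinguished hS)
    naturality h₁ h₂ φ := by
      apply G.map_injective
      rw [← cancel_mono ((G.commShiftIso (1 : ℤ)).hom.app _), G.map_comp, G.map_comp,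
        Category.assoc, Category.assoc, hδ, G.commShiftIso_hom_naturality, reassoc_of% hδ h₁]
      exact d.naturality h₁ h₂ φ }

lemma isIso_δ {S : ShortComplex A} (hS : S.ShortExact) (h₂ : IsZero (F.obj S.X₂)) :
    IsIso (d.δ hS) :=
  (Triangle.isZero₂_iff_isIso₃ _ (d.distinguished hS)).1 h₂

lemma distinguished_of_isPushout {S : ShortComplex A} (hS : S.ShortExact)
    (h₂ : IsZero (F.obj S.X₂)) {Y Z : A} {u : S.X₁ ⟶ Y} {v : Y ⟶ Z} {j : S.X₂ ⟶ Z}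
    {w : Z ⟶ S.X₃} (h : IsPushout u S.f v j) (hvw : v ≫ w = 0) (hjw : j ≫ w = S.g) :
    Triangle.mk (F.map u) (F.map v) (F.map w ≫ (-d.δ hS)) ∈ distTriang C := by
  have := d.isIso_δ hS h₂
  have hT := shortExact_of_isPushout hS h hvw hjw
  have hδ : d.δ hT = d.δ hS ≫ (F.map u)⟦(1 : ℤ)⟧' := by
    have := d.naturality hS hT
      { τ₁ := u, τ₂ := j, τ₃ := 𝟙 _, comm₁₂ := h.w, comm₂₃ := by simp [hjw] }
    dsimp at this
    rwa [F.map_id, Category.id_comp] at this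
  rw [rotate_distinguished_triangle]
  refine isomorphic_distinguished _ (d.distinguished hT) _
    (Triangle.isoMk _ _ (Iso.refl _) (Iso.refl _) (-(asIso (d.δ hS))).symm ?_ ?_ ?_)
  · exact (Category.comp_id _).trans (Category.id_comp _).symm
  · change (F.map w ≫ (-d.δ hS)) ≫ (-inv (d.δ hS)) = 𝟙 _ ≫ F.map w
    simp
  · change (-(F.map u)⟦(1 : ℤ)⟧') ≫ (𝟙 _)⟦(1 : ℤ)⟧' = (-inv (d.δ hS)) ≫ d.δ (S := .mk v w hvw) hT
    rw [hδ, CategoryTheory.Functor.map_id, Category.comp_id, Preadditive.neg_comp,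
      IsIso.inv_hom_id_assoc]

include d in
lemma nonempty_retract {S T : ShortComplex A} (hS : S.ShortExact) (hT : T.ShortExact)
    (hS₂ : IsZero (F.obj S.X₂)) (hT₂ : IsZero (F.obj T.X₂))
    (r : Retract (F.obj S.X₃) (F.obj T.X₃)) : Nonempty (Retract (F.obj S.X₁) (F.obj T.X₁)) := by
  have := d.isIso_δ hS hS₂
  have := d.isIso_δ hT hT₂
  let s := shiftFunctor C (1 : ℤ)
  refine ⟨s.preimage (inv (d.δ hS) ≫ r.i ≫ d.δ hT), s.preimage (inv (d.δ hT) ≫ r.r ≫ d.δ hS),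
    s.map_injective ?_⟩
  rw [s.map_comp, s.map_preimage, s.map_preimage, s.map_id]
  simp

end DeltaStructure
end

section
open Pretriangulated DerivedCategory
variable {R : Type u} [Ring R] [IsLeftCoherentRing R]

/-- The connecting morphisms in `D_sg(R)` of short exact sequences of modules. -/
noncomputable def dsgDelta : DeltaStructure (moduleToDsg R) :=
  (DeltaStructure.ofComp Bounded.ι (F := stalk R) DeltaStructure.single).comp (toDsg R)

instance : (toStable R).Additive := CategoryTheory.Quotient.functor_additive _ _

instance : (GprojToDsg R).Additive := by
  dsimp only [GprojToDsg]
  infer_instance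

instance : (Phi R).Additive := by
  have : (toStable R ⋙ Phi R).Additive := inferInstanceAs (GprojToDsg R).Additive
  exact Functor.additive_of_full_essSurj_comp (toStable R) (Phi R)

instance : (Phi R).Full where
  map_surjective {X Y} φ := by
    obtain ⟨f, hf⟩ := X.as.property.extVanishAbove.exists_map_eq (Y := Y.as.obj) φ
    exact ⟨(toStable R).map (ObjectProperty.homMk f), hf⟩

instance : (Phi R).Faithful where
  map_injective {X Y} f g h := by
    obtain ⟨f, rfl⟩ := (toStable R).map_surjective f
    obtain ⟨g, rfl⟩ := (toStable R).map_surjective g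
    refine CategoryTheory.Quotient.sound _
      (X.as.property.extVanishAbove.factorsThroughProj (f.hom - g.hom) ?_)
    rw [Functor.map_sub, sub_eq_zero]
    exact h

lemma isZero_moduleToDsg_obj (P : FPMod R) [Projective P] : IsZero ((moduleToDsg R).obj P) :=
  isZero_toDsg_stalk R P ((isProj_iff P).2 ‹_›)

instance (X : Gproj R) : IsIso (dsgDelta.δ (cosyzygy X).shortExact) :=
  dsgDelta.isIso_δ _ (isZero_moduleToDsg_obj _)

/-- The isomorphism `S(X) ≅ X[1]` in `D_sg(R)` given by the connecting morphism of the chosen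
conflation. With the sign, standard triangles become distinguished without changing their maps. -/
noncomputable def suspensionIso (X : Gproj R) :
    (moduleToDsg R).obj (cosyzygy X).S.obj ≅ ((moduleToDsg R).obj X.obj)⟦(1 : ℤ)⟧ :=
  -(asIso (dsgDelta.δ (cosyzygy X).shortExact))

lemma suspensionIso_naturality {X Y : Gproj R} (f : X ⟶ Y) :
    (moduleToDsg R).map (cosyzygyMap f).hom ≫ (suspensionIso Y).hom =
      (suspensionIso X).hom ≫ ((moduleToDsg R).map f.hom)⟦(1 : ℤ)⟧' := by
  obtain ⟨g, hg, hg'⟩ := cosyzygyMap_spec f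
  have := dsgDelta.naturality (cosyzygy X).shortExact (cosyzygy Y).shortExact
    { τ₁ := f.hom, τ₂ := g, τ₃ := (cosyzygyMap f).hom, comm₁₂ := hg.symm, comm₂₃ := hg'.symm }
  simp only [suspensionIso, Preadditive.neg_iso_hom, asIso_hom]
  rw [Preadditive.comp_neg, Preadditive.neg_comp, this]

/-- The compatibility of `Φ_R` with suspensions. -/
noncomputable def phiSuspensionIso :
    stableSuspension R ⋙ Phi R ≅ Phi R ⋙ shiftFunctor (Dsg R) (1 : ℤ) :=
  NatIso.ofComponents (fun X => suspensionIso X.as) (fun {X Y} f => by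
    obtain ⟨f, rfl⟩ := (toStable R).map_surjective f
    exact suspensionIso_naturality f)

lemma IsStandardTriangle.distinguished {X Y Z : Gproj R} {u : X ⟶ Y} {v : Y ⟶ Z}
    {w : Z ⟶ (cosyzygy X).S} (h : IsStandardTriangle u v w) :
    Triangle.mk ((moduleToDsg R).map u.hom) ((moduleToDsg R).map v.hom)
      ((moduleToDsg R).map w.hom ≫ (suspensionIso X).hom) ∈ distTriang (Dsg R) := by
  obtain ⟨j, hj, hvw, hjw⟩ := h
  exact dsgDelta.distinguished_of_isPushout (cosyzygy X).shortExact
    (isZero_moduleToDsg_obj _) hj hvw hjw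

lemma isTriangleFunctor_phi : IsTriangleFunctor R (Phi R) := by
  refine ⟨inferInstance, phiSuspensionIso, ?_⟩
  rintro X Y Z u v w ⟨X', Y', Z', u', v', w', a, b, c, h, hu, hv, hw⟩
  have hw' : (Phi R).map w ≫ (Phi R).map ((stableSuspension R).map a.hom) =
      (Phi R).map c.hom ≫ (Phi R).map ((toStable R).map w') :=
    ((Phi R).map_comp _ _).symm.trans
      ((congrArg (Phi R).map hw).trans ((Phi R).map_comp _ _))
  have hw'' : ((Phi R).map w ≫ phiSuspensionIso.hom.app X) ≫ ((Phi R).map a.hom)⟦(1 : ℤ)⟧' =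
      (Phi R).map c.hom ≫ (Phi R).map ((toStable R).map w') ≫ (suspensionIso X').hom := by
    have hη := phiSuspensionIso.hom.naturality a.hom
    dsimp only [Functor.comp_map] at hη
    rw [Category.assoc, ← hη, reassoc_of% hw']
    exact Category.assoc _ _ _
  refine isomorphic_distinguished _ h.distinguished _
    (Triangle.isoMk _ _ ((Phi R).mapIso a) ((Phi R).mapIso b) ((Phi R).mapIso c) ?_ ?_ hw'')
  · exact (Functor.map_comp ..).symm.trans ((congrArg (Phi R).map hu).trans (Functor.map_comp ..))
  · exact (Functor.map_comp ..).symm.trans ((congrArg (Phi R).map hv).trans (Functor.map_comp ..))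

end

/-! ### Gorenstein projective dimension and density -/

section
open Pretriangulated
variable {R : Type u} [Ring R] [IsLeftCoherentRing R]

lemma exists_extVanishAbove_of_retract {M G : FPMod R} (hG : isGorensteinProjective R G)
    (r : Retract ((moduleToDsg R).obj M) ((moduleToDsg R).obj G)) :
    ∃ n : ℕ, ExtVanishAbove n M := by
  obtain ⟨P, P', hP, hP', h⟩ := exists_hom_eq_zero_of_retract (isPerfectBounded R) (toDsg R) r
  obtain ⟨m, hm⟩ := exists_forall_hom_shift_eq_zero hP
  obtain ⟨m', hm'⟩ := exists_forall_hom_shift_eq_zero hP'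
  exact ⟨(max m m').toNat, extVanishAbove_of_stalk_hom_eq_zero fun Q _ n hn =>
    h _ (hm Q n (by lia)) (hm' Q n (by lia)) (hG.extVanishAbove.stalk_hom_eq_zero (by lia))⟩

lemma isGorensteinProjective.gpdLE {G : FPMod R} (hG : isGorensteinProjective R G) :
    GpdLE G 0 := by
  let C := (ChainComplex.single₀ (FPMod R)).obj G
  have hC (i : ℕ) : IsZero (C.X (i + 1)) :=
    HomologicalComplex.isZero_single_obj_X _ _ _ _ i.succ_ne_zero
  have : Mono (𝟙 G) := inferInstance
  refine ⟨C, 𝟙 G, ?_, ?_, Function.surjective_id, ?_, fun i => ?_⟩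
  · rintro (_ | i)
    · exact hG
    · have := (hC i).projective
      exact .of_projective
  · rintro (_ | i) hi
    exacts [absurd hi (lt_irrefl 0), hC i]
  · exact (FPMod.exact_iff (ShortComplex.mk (0 : C.X 1 ⟶ G) (𝟙 G) zero_comp)).1
      ((ShortComplex.exact_iff_mono _ rfl).2 this)
  · exact (FPMod.exact_iff (ShortComplex.mk _ _ (C.d_comp_d _ _ _))).1
      (ShortComplex.exact_of_isZero_X₂ _ (hC i))

lemma GpdLE.of_shortExact {S : ShortComplex (FPMod R)} (hS : S.ShortExact)
    (h₂ : isGorensteinProjective R S.X₂) {n : ℕ} (h₁ : GpdLE S.X₁ n) : GpdLE S.X₃ (n + 1) := by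
  obtain ⟨C, ε, hC, hn, hε, hε', hex⟩ := h₁
  have hinj := (FPMod.mono_iff S.f).1 hS.mono_f
  have hexS := (FPMod.exact_iff S).1 hS.exact
  have hw : C.d 1 0 ≫ ε ≫ S.f = 0 := by
    ext x
    change S.f.hom.hom (ε.hom.hom ((C.d 1 0).hom.hom x)) = 0
    rw [hε'.apply_apply_eq_zero, map_zero]
  refine ⟨C.augment (ε ≫ S.f) hw, S.g, ?_, ?_, (FPMod.epi_iff S.g).1 hS.epi_g, ?_, ?_⟩
  · rintro (_ | i)
    exacts [h₂, hC i]
  · rintro (_ | i) hi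
    exacts [absurd hi (by lia), hn i (by lia)]
  · intro y
    have hr : Set.range (S.f.hom.hom ∘ ε.hom.hom) = Set.range S.f.hom.hom := hε.range_comp _
    exact (hexS y).trans (iff_of_eq (congrArg (y ∈ ·) hr.symm))
  · rintro (_ | i)
    · exact fun y => (map_eq_zero_iff S.f.hom.hom hinj).trans (hε' y)
    · exact hex i

lemma isGorensteinProjective_of_retract {M G : FPMod R} (hM : ExtVanishAbove 0 M)
    (hG : isGorensteinProjective R G)
    (r : Retract ((moduleToDsg R).obj M) ((moduleToDsg R).obj G)) :
    isGorensteinProjective R M := by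
  obtain ⟨i, hi⟩ := hM.exists_map_eq r.i
  obtain ⟨p, hp⟩ := hG.extVanishAbove.exists_map_eq r.r
  have hmap : (moduleToDsg R).map (𝟙 M - i ≫ p) = 0 := by
    rw [Functor.map_sub, Functor.map_comp, hi, hp, r.retract, CategoryTheory.Functor.map_id,
      sub_self]
  obtain ⟨P, hP, a, b, hab⟩ := hM.factorsThroughProj _ hmap
  have := (isProj_iff P).1 hP
  let r' : Retract M (G ⊞ P) :=
    { i := biprod.lift i a
      r := biprod.desc p b
      retract := by rw [biprod.lift_desc, hab]; abel }
  exact ObjectProperty.prop_of_retract _ r'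
    (ObjectProperty.prop_biprod _ hG .of_projective)

lemma exists_gpdLE_of_retract {n : ℕ} {M G : FPMod R} (hM : ExtVanishAbove n M)
    (hG : isGorensteinProjective R G)
    (r : Retract ((moduleToDsg R).obj M) ((moduleToDsg R).obj G)) : ∃ k, GpdLE M k := by
  induction n generalizing M G with
  | zero => exact ⟨0, (isGorensteinProjective_of_retract hM hG r).gpdLE⟩
  | succ n ih =>
    obtain ⟨T, hT, rfl, _, hT₁⟩ := hG.exists_shortExact
    let S := ShortComplex.mk (kernel.ι (Projective.π M)) (Projective.π M) (kernel.condition _)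
    have hS : S.ShortExact := { exact := ShortComplex.exact_kernel _ }
    obtain ⟨r'⟩ := dsgDelta.nonempty_retract hS hT (isZero_moduleToDsg_obj _)
      (isZero_moduleToDsg_obj _) r
    obtain ⟨k, hk⟩ := ih (hM.syzygy hS) hT₁ r'
    exact ⟨k + 1, GpdLE.of_shortExact hS .of_projective hk⟩

lemma DenseUpToSummands.isLeftGRegular (h : DenseUpToSummands R (Phi R)) : IsLeftGRegular R := by
  intro M
  obtain ⟨G, Y, ⟨e⟩⟩ := h ((moduleToDsg R).obj M)
  let r : Retract ((moduleToDsg R).obj M) ((Phi R).obj G) :=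
    { i := biprod.inl ≫ e.inv
      r := e.hom ≫ biprod.fst }
  obtain ⟨n, hn⟩ := exists_extVanishAbove_of_retract G.as.property r
  exact exists_gpdLE_of_retract hn G.as.property r

end

section
open Pretriangulated DerivedCategory
variable {C : Type*} [Category* C] [Preadditive C] [HasZeroObject C] [HasShift C ℤ]
  [∀ n : ℤ, (shiftFunctor C n).Additive] [Pretriangulated C]

lemma isTriangulated_of_shift_neg_one {T : ObjectProperty C} [T.IsClosedUnderIsomorphisms]
    [T.ContainsZero] [T.IsTriangulatedClosed₃] (h : ∀ X, T X → T (X⟦(-1 : ℤ)⟧)) :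
    T.IsTriangulated := by
  have h' (X : C) (hX : T X) : T (X⟦(1 : ℤ)⟧) :=
    T.ext_of_isTriangulatedClosed₃ _ (contractible_distinguished₂ X) hX T.prop_zero
  have : T.IsStableUnderShift ℤ :=
    ⟨fun n => ⟨fun X hX => by
      induction n with
      | zero => exact T.prop_of_iso ((shiftFunctorZero C ℤ).app X).symm hX
      | succ n ih =>
        exact T.prop_of_iso ((shiftFunctorAdd' C (n : ℤ) 1 _ rfl).app X).symm (h' _ ih)
      | pred n ih =>
        exact T.prop_of_iso ((shiftFunctorAdd' C (-n : ℤ) (-1) _ rfl).app X).symm (h _ ih)⟩⟩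
  exact { toIsTriangulatedClosed₂ := .of_isTriangulatedClosed₃ }

variable {A : Type*} [Category* A] [Abelian A] [HasDerivedCategory A]

lemma prop_Q_obj_of_single (T : ObjectProperty (DerivedCategory A)) [T.IsTriangulated]
    [T.IsClosedUnderIsomorphisms] (h : ∀ X : A, T ((singleFunctor A 0).obj X)) (d : ℕ)
    (K : CochainComplex A ℤ) (a b : ℤ) (hab : b < a + d) [K.IsStrictlyGE a] [K.IsStrictlyLE b] :
    T (Q.obj K) := by
  induction d generalizing K a with
  | zero =>
    refine T.prop_of_isZero (Q.map_isZero ((IsZero.iff_id_eq_zero K).2 ?_))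
    ext i
    obtain hi | hi : i < a ∨ b < i := by lia
    · exact (K.isZero_of_isStrictlyGE a i hi).eq_of_src _ _
    · exact (K.isZero_of_isStrictlyLE b i hi).eq_of_src _ _
  | succ d ih =>
    refine T.ext_of_isTriangulatedClosed₂ _
      (triangleOfSES_distinguished (shortExact_toLowestTerm K a))
      (ih (kernel (toLowestTerm K a)) (a + 1) (by push_cast at hab; lia)) ?_
    exact T.prop_of_iso (((singleFunctors A).shiftIso (-a) a 0 (by lia)).app (K.X a))
      (T.le_shift _ _ (h (K.X a)))

end

section
open Pretriangulated DerivedCategory ZeroObject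
variable {R : Type u} [Ring R] [IsLeftCoherentRing R]

lemma exists_isStandardTriangle {X Y : Gproj R} (u : X ⟶ Y) :
    ∃ (Z : Gproj R) (v : Y ⟶ Z) (w : Z ⟶ (cosyzygy X).S), IsStandardTriangle u v w := by
  let c := cosyzygy X
  have hp := IsPushout.of_hasPushout u.hom c.ι
  let w : pushout u.hom c.ι ⟶ c.S.obj := pushout.desc 0 c.π (by rw [comp_zero, c.ι_π])
  have hS := shortExact_of_isPushout c.shortExact hp (w := w) (pushout.inl_desc _ _ _)
    (pushout.inr_desc _ _ _)
  have hZ : isGorensteinProjective R (pushout u.hom c.ι) :=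
    ObjectProperty.prop_X₂_of_shortExact _ hS Y.property c.S.property
  exact ⟨⟨_, hZ⟩, ObjectProperty.homMk (pushout.inl u.hom c.ι), ObjectProperty.homMk w,
    pushout.inr u.hom c.ι, hp, pushout.inl_desc _ _ _, pushout.inr_desc _ _ _⟩

lemma isGorensteinProjective.essImage_phi {G : FPMod R} (hG : isGorensteinProjective R G) :
    (Phi R).essImage ((moduleToDsg R).obj G) :=
  (Phi R).obj_mem_essImage ((toStable R).obj ⟨G, hG⟩)

instance : (Phi R).essImage.ContainsZero where
  exists_zero := ⟨_, isZero_moduleToDsg_obj (0 : FPMod R),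
    isGorensteinProjective.of_projective.essImage_phi⟩

instance : (Phi R).essImage.IsTriangulatedClosed₃ := .mk' fun T hT h₁ h₂ => by
  obtain ⟨X, ⟨e₁⟩⟩ := h₁
  obtain ⟨Y, ⟨e₂⟩⟩ := h₂
  obtain ⟨u, hu⟩ := (toStable R ⋙ Phi R).map_surjective (X := X.as) (Y := Y.as)
    (e₁.hom ≫ T.mor₁ ≫ e₂.inv)
  obtain ⟨Z, v, w, h⟩ := exists_isStandardTriangle u
  have hcomm : (toStable R ⋙ Phi R).map u ≫ e₂.hom = e₁.hom ≫ T.mor₁ := by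
    rw [hu, Category.assoc, Category.assoc, e₂.inv_hom_id, Category.comp_id]
  exact ⟨(toStable R).obj Z,
    ⟨Triangle.π₃.mapIso (isoTriangleOfIso₁₂ _ _ h.distinguished hT e₁ e₂ hcomm)⟩⟩

instance : (Phi R).essImage.IsTriangulated := isTriangulated_of_shift_neg_one fun X hX => by
  obtain ⟨G, ⟨e⟩⟩ := hX
  obtain ⟨S, hS, hG, _, hK⟩ := G.as.property.exists_shortExact
  have := dsgDelta.isIso_δ hS (isZero_moduleToDsg_obj _)
  let e' : X ≅ ((moduleToDsg R).obj S.X₁)⟦(1 : ℤ)⟧ :=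
    e.symm ≪≫ (moduleToDsg R).mapIso (eqToIso hG.symm) ≪≫ asIso (dsgDelta.δ hS)
  exact (Phi R).essImage.prop_of_iso ((shiftShiftNeg ((moduleToDsg R).obj S.X₁) (1 : ℤ)).symm ≪≫
    (shiftFunctor (Dsg R) (-1 : ℤ)).mapIso e'.symm) hK.essImage_phi

lemma GpdLE.induction {T : ObjectProperty (FPMod R)} (hG : isGorensteinProjective R ≤ T)
    (hT : ∀ S : ShortComplex (FPMod R), S.ShortExact → T S.X₁ → T S.X₂ → T S.X₃) {n : ℕ}
    {M : FPMod R} (h : GpdLE M n) : T M := by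
  induction n generalizing M with
  | zero =>
    obtain ⟨C, ε, hC, hn, hε, hex, -⟩ := h
    have : Epi ε := (FPMod.epi_iff ε).2 hε
    have hd : C.d 1 0 = 0 := (hn 1 (by lia)).eq_of_src _ _
    have hS : (ShortComplex.mk (C.d 1 0) ε (by rw [hd, zero_comp])).ShortExact :=
      { exact := (FPMod.exact_iff _).2 hex
        mono_f := ⟨fun _ _ _ => (hn 1 (by lia)).eq_of_tgt _ _⟩
        epi_g := this }
    exact hT _ hS (hG _ (hC 1)) (hG _ (hC 0))
  | succ n ih =>
    obtain ⟨C, ε, hC, hn, hε, hex₀, hex⟩ := h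
    have : Epi ε := (FPMod.epi_iff ε).2 hε
    have hS : (ShortComplex.mk (kernel.ι ε) ε (kernel.condition ε)).ShortExact :=
      { exact := ShortComplex.exact_kernel ε }
    have hinj := (FPMod.mono_iff _).1 hS.mono_f
    have hker := (FPMod.exact_iff _).1 hS.exact
    have hw : C.d 1 0 ≫ ε = 0 := by ext x; exact hex₀.apply_apply_eq_zero x
    have hl (x) : (kernel.ι ε).hom.hom ((kernel.lift ε (C.d 1 0) hw).hom.hom x) =
        (C.d 1 0).hom.hom x :=
      LinearMap.congr_fun (congrArg (fun f => f.hom.hom) (kernel.lift_ι ε (C.d 1 0) hw)) x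
    refine hT _ hS (ih ⟨ChainComplex.truncate.obj C, kernel.lift ε (C.d 1 0) hw,
      fun i => hC (i + 1), fun i hi => hn (i + 1) (by lia), fun y => ?_, fun y => ?_,
      fun i => hex (i + 1)⟩) (hG _ (hC 0))
    · obtain ⟨x, hx⟩ := (hex₀ ((kernel.ι ε).hom.hom y)).1 (hker.apply_apply_eq_zero y)
      exact ⟨x, hinj ((hl x).trans hx)⟩
    · exact (map_eq_zero_iff _ hinj).symm.trans
        ((iff_of_eq (congrArg (· = 0) (hl y))).trans (hex 0 y))

lemma IsLeftGRegular.essImage_phi (hR : IsLeftGRegular R) (M : FPMod R) :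
    (Phi R).essImage ((moduleToDsg R).obj M) := by
  obtain ⟨n, hn⟩ := hR M
  exact hn.induction (T := (Phi R).essImage.inverseImage (moduleToDsg R))
    (fun _ hG => hG.essImage_phi)
    (fun _ hS h₁ h₂ => (Phi R).essImage.ext_of_isTriangulatedClosed₃ _
      (dsgDelta.distinguished hS) h₁ h₂)

lemma IsLeftGRegular.essImage_phi_toDsg (hR : IsLeftGRegular R) (X : Bounded (FPMod R)) :
    (Phi R).essImage ((toDsg R).obj X) := by
  obtain ⟨⟨a, ha⟩, ⟨b, hb⟩⟩ := X.property
  obtain ⟨K, _, _, ⟨e⟩⟩ := exists_iso_Q_obj_of_isGE_of_isLE X.obj a b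
  let T := (Phi R).essImage.inverseImage (toDsg R)
  obtain ⟨Y, hY, ⟨e'⟩⟩ : (T.map Bounded.ι) (Q.obj K) :=
    prop_Q_obj_of_single _ (fun M => T.prop_map_obj Bounded.ι (X := (stalk R).obj M)
      (hR.essImage_phi M)) (b + 1 - a).toNat K a b (by lia)
  exact T.prop_of_iso (Bounded.ι.preimageIso (e' ≪≫ e.symm)) hY

lemma IsLeftGRegular.essSurj_phi (hR : IsLeftGRegular R) : (Phi R).EssSurj where
  mem_essImage Y := by
    have := Localization.essSurj (toDsg R) (isPerfectBounded R).trW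
    exact (Phi R).essImage.prop_of_iso ((toDsg R).objObjPreimageIso Y)
      (hR.essImage_phi_toDsg ((toDsg R).objPreimage Y))

lemma denseUpToSummands_of_essSurj [(Phi R).EssSurj] : DenseUpToSummands R (Phi R) := fun X =>
  ⟨(Phi R).objPreimage X, 0, ⟨(Phi R).objObjPreimageIso X ≪≫ isoBiprodZero (isZero_zero _)⟩⟩

end

end SingCat

theorem theorem4p10 (R : Type u) [Ring R] [SingCat.IsLeftCoherentRing R] :
    (SingCat.Phi R).Full ∧ (SingCat.Phi R).Faithful ∧
      SingCat.IsTriangleFunctor R (SingCat.Phi R) ∧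
      ((SingCat.Phi R).EssSurj ↔ SingCat.DenseUpToSummands R (SingCat.Phi R)) ∧
      (SingCat.DenseUpToSummands R (SingCat.Phi R) ↔ SingCat.IsLeftGRegular R) :=
  ⟨inferInstance, inferInstance, SingCat.isTriangleFunctor_phi,
    ⟨fun _ => SingCat.denseUpToSummands_of_essSurj, fun h => h.isLeftGRegular.essSurj_phi⟩,
    ⟨fun h => h.isLeftGRegular, fun h =>
      have := h.essSurj_phi
      SingCat.denseUpToSummands_of_essSurj⟩⟩
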